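/- All functions $u=u(n,t)$ are complex-valued, $n\in\mathbb Z$, $t\in\mathbb R$ (real-valued functions are a special case); $u^{(k)}(n,t)=u(n+k,t)$, $E u=u^{(1)}$, and $(\Delta^{-1}u)(n)=\sum_{i=0}^{n-1}u(i)$ for $n\ge 0$, $=-\sum_{i=n}^{-1}u(i)$ for $n\le -1$. The Toda lattice with $N$ self-consistent sources (TLSCS) is the system, for $v,p$, the sources $\phi_{j\pm}$ (differentiable in $t$) and constants $\lambda_j$, $j=1,\dots,N$, $$v_t=v\Big(p^{(-1)}+\sum_j\phi_{j-}^{(-1)}\phi_{j+}^{(-1)}\Big)-v\Big(p+\sum_j\phi_{j-}\phi_{j+}\Big),$$ $$p_t=v\Big(1+\sum_j\phi_{j-}^{(-1)}\phi_{j+}\Big)-v^{(1)}\Big(1+\sum_j\phi_{j-}\phi_{j+}^{(1)}\Big),$$ $$L\phi_{j+}=\lambda_j\phi_{j+},\quad L^*\phi_{j-}=\lambda_j\phi_{j-},\qquad L\psi=v^{(1)}\psi^{(1)}+p\psi+\psi^{(-1)},\quad L^*\phi=v\phi^{(-1)}+p\phi+\phi^{(1)}.$$ With $v=\exp(x^{(-1)}-x)$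 and $p=x_t-\sum_j\phi_{j+}\phi_{j-}$ the equations for $v,p$ become $$(\ast)\quad x_{tt}=e^{x^{(-1)}-x}\Big(1+\sum_j\phi_{j+}\phi_{j-}^{(-1)}\Big)-e^{x-x^{(1)}}\Big(1+\sum_j\phi_{j+}^{(1)}\phi_{j-}\Big)+\sum_j(\phi_{j+}\phi_{j-})_t .$$ For $\lambda\notin\{\lambda_j\}$ an eigenfunction at $\lambda$ is a $\psi$ with $L\psi=\lambda\psi$ and $-\psi_t=v^{(1)}\psi^{(1)}+\sum_j\frac1{\lambda-\lambda_j}v^{(1)}\phi_{j-}(\phi_{j+}^{(1)}\psi-\phi_{j+}\psi^{(1)})$. For $\mu\ne\lambda_i$ put $S_i(h)=\Delta^{-1}E(\phi_{i-}h)+(\mu-\lambda_i)^{-1}[v^{(1)}h^{(1)}\phi_{i-}-h\phi_{i-}^{(1)}]_{n=0}$. The forward Darboux transformation (FDT) at $\mu$ generated by two eigenfunctions $f,g$ at $\mu$, $h=f+\alpha(t)g$, and functions $c(t),d(t)$ with $cd=-\dot\alpha/\alpha$ is $\psi\mapsto\psi-\frac{h}{h^{(1)}}\psi^{(1)}$,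 $v\mapsto v^{(1)}\frac{h^{(1)}h^{(-1)}}{h^2}$, $p\mapsto p-\frac h{h^{(1)}}+\frac{h^{(-1)}}h$, $x\mapsto x^{(1)}+\frac12\log\big(\frac h{h^{(1)}}\big)^2$, $\phi_{i+}\mapsto\phi_{i+}-\frac h{h^{(1)}}\phi_{i+}^{(1)}$, $\phi_{i-}\mapsto S_i(h)/h$, together with the additional source $c\,(f-\frac h{h^{(1)}}f^{(1)})$, $d/h$ with eigenvalue $\mu$. In the $l$-times repeated FDT, step $k$ is generated by the images of $f_k,g_k$ under the previous steps. Write $\mathrm{cas}(h_1,\dots,h_l)=\det(h_i^{(j)})_{1\le i\le l,\;0\le j\le l-1}$, $\widetilde{\mathrm{cas}}(h_1,\dots,h_l)=\det(h_i^{(j)})_{1\le i\le l,\;j=0,2,3,\dots,l}$, and let $\overline{\mathrm{cas}}(\phi_{i-},h_1,\dots,h_l)$ be the determinant with first row $S_i(h_1),\dots,S_i(h_l)$ (where $S_i(h_j)$ is taken with $\mu=\mu_j$) and further rows $h_1^{(k)},\dots,h_l^{(k)}$, $k=1,\dots,l-1$. **Theorem.** Let $l\ge1$. Let $v,p,x,\phi_{i\pm}$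 ($i=1,\dots,N$) be a solution of the TLSCS and of $(\ast)$ on $\mathbb Z\times\mathbb R$, with $v=\exp(x^{(-1)}-x)$ and $p=x_t-\sum\phi_{i+}\phi_{i-}$. Let $f_j,g_j$ be eigenfunctions at $\mu_j$ ($j=1,\dots,l$), where the $\mu_j$ are distinct and different from all $\lambda_i$, and let $\psi$ be an eigenfunction at some $\lambda\notin\{\lambda_i\}\cup\{\mu_j\}$. Let $\alpha_j,c_j,d_j$ be differentiable functions of $t$ with $\alpha_j$ nowhere zero and $c_jd_j=(-1)^j\dot\alpha_j/\alpha_j$; put $h_j=f_j+\alpha_jg_j$, $\mathrm{cas}=\mathrm{cas}(h_1,\dots,h_l)$, $\widetilde{\mathrm{cas}}=\widetilde{\mathrm{cas}}(h_1,\dots,h_l)$, and $$\psi[l]=\frac{\mathrm{cas}(\psi,h_1,\dots,h_l)}{\mathrm{cas}^{(1)}},\quad v[l]=v^{(l)}\frac{\mathrm{cas}^{(1)}\mathrm{cas}^{(-1)}}{\mathrm{cas}^2},\quad p[l]=p+\frac{\widetilde{\mathrm{cas}}^{(-1)}}{\mathrm{cas}}-\frac{\widetilde{\mathrm{cas}}}{\mathrm{cas}^{(1)}},\quad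 x[l]=x^{(l)}+\frac12\log\Big[\frac{\mathrm{cas}}{\mathrm{cas}^{(1)}}\Big]^2,$$ $$\phi_{i+}[l]=\frac{\mathrm{cas}(\phi_{i+},h_1,\dots,h_l)}{\mathrm{cas}^{(1)}},\quad \phi_{i-}[l]=\frac{\overline{\mathrm{cas}}(\phi_{i-},h_1,\dots,h_l)}{\mathrm{cas}}\quad(i\le N),$$ $$\phi_{N+j,+}[l]=c_j\frac{\mathrm{cas}(f_j,h_1,\dots,h_l)}{\mathrm{cas}^{(1)}},\quad \phi_{N+j,-}[l]=d_j\frac{\mathrm{cas}(h_1,\dots,\widehat{h_j},\dots,h_l)^{(1)}}{\mathrm{cas}},\quad\lambda_{N+j}=\mu_j\quad(j\le l).$$ 1. At every time at which $\mathrm{cas}(h_1,\dots,h_k)$ has no zero in $n$ for each $k\le l$, these are the fields, sources and eigenfunction produced by the $l$-times repeated FDT whose step $k$ uses $f_k,g_k,\alpha_k$ and the functions $c_k$, $(-1)^{k-1}d_k$; for $x[l]$ the equality is up to the choice of the logarithms, that is, up to an integer multiple of $\pi i$ (for real functions it is exact). 2. At every point $(n,t)$ with $\mathrm{cas}\ne0$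 at $n-1,n,n+1,n+2$, the functions $v[l],p[l],\phi_{i\pm}[l]$, $\lambda_i$ ($i=1,\dots,N+l$) satisfy the TLSCS with $N+l$ sources, and $\psi[l]$ satisfies the equations of an eigenfunction at $\lambda$ for it. If $\log$ in $x[l]$ is a continuous branch near $t$ (for real functions, the ordinary logarithm), then moreover $x[l]_t=p[l]+\sum_{i=1}^{N+l}\phi_{i+}[l]\phi_{i-}[l]$ and $\exp(x[l]^{(-1)}-x[l])=\pm v[l]$; and $x[l]$ satisfies $(\ast)$ with $N+l$ sources at $(n,t)$ if the sign is $+$ at $(n,t)$ and at $(n+1,t)$ (for real functions: if $v[l]>0$ there). -/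

import Mathlib

/-- Complex-valued functions `u(n,t)` of a lattice site `n ∈ ℤ` and a time `t ∈ ℝ`;
`u n t` is `u(n,t)`, and the shift `u^{(k)}` is `fun n t => u (n + k) t`. -/
abbrev LatticeFn : Type := ℤ → ℝ → ℂ

/-- The inverse difference operator:
`(Δ⁻¹u)(n) = ∑_{i=0}^{n-1} u(i)` for `n ≥ 0` (so `0` for `n = 0`) and
`-∑_{i=n}^{-1} u(i)` for `n ≤ -1`. -/
noncomputable def invDelta (u : LatticeFn) : LatticeFn := fun n t =>
  if 0 ≤ n then ∑ i ∈ Finset.Ico (0 : ℤ) n, u i t else -∑ i ∈ Finset.Ico n (0 : ℤ), u i t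

/-- The fields of a Toda lattice with `N` sources: `v`, `p`, `x`, the sources `φ_{j+}`, `φ_{j-}`
and the eigenvalues `λ_j` they belong to. -/
structure TodaState (N : ℕ) where
  v : LatticeFn
  p : LatticeFn
  x : LatticeFn
  plus : Fin N → LatticeFn
  minus : Fin N → LatticeFn
  ev : Fin N → ℂ

/-- `Lψ = (vψ)^{(1)} + pψ + ψ^{(-1)}`. -/
def todaL (v p ψ : LatticeFn) : LatticeFn := fun n t =>
  v (n + 1) t * ψ (n + 1) t + p n t * ψ n t + ψ (n - 1) t

/-- `L*φ = vφ^{(-1)} + pφ + φ^{(1)}`. -/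
def todaLAdj (v p φ : LatticeFn) : LatticeFn := fun n t =>
  v n t * φ (n - 1) t + p n t * φ n t + φ (n + 1) t

namespace TodaState

variable {N : ℕ}

/-- The Toda lattice equation with `N` self-consistent sources, at the site `n` and time `t`. -/
structure SolvesTLSCSAt (S : TodaState N) (n : ℤ) (t : ℝ) : Prop where
  v_eq : HasDerivAt (S.v n)
    (S.v n t * (S.p (n - 1) t + ∑ j, S.minus j (n - 1) t * S.plus j (n - 1) t)
      - S.v n t * (S.p n t + ∑ j, S.minus j n t * S.plus j n t)) t
  p_eq : HasDerivAt (S.p n)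
    (S.v n t * (1 + ∑ j, S.minus j (n - 1) t * S.plus j n t)
      - S.v (n + 1) t * (1 + ∑ j, S.minus j n t * S.plus j (n + 1) t)) t
  plus_eq : ∀ j, todaL S.v S.p (S.plus j) n t = S.ev j * S.plus j n t
  minus_eq : ∀ j, todaLAdj S.v S.p (S.minus j) n t = S.ev j * S.minus j n t
  plus_diff : ∀ j, DifferentiableAt ℝ (S.plus j n) t
  minus_diff : ∀ j, DifferentiableAt ℝ (S.minus j n) t

/-- `ψ` is an eigenfunction of the Lax pair with spectral parameter `lam`, at `(n,t)`: it satisfies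
`Lψ = lam ψ` and
`-ψ_t = v^{(1)}ψ^{(1)} + ∑_j (lam - λ_j)⁻¹ v^{(1)} φ_{j-} (φ_{j+}^{(1)} ψ - φ_{j+} ψ^{(1)})`.
(Meaningful when `lam` is none of the `λ_j`.) -/
structure IsEigenfunctionAt (S : TodaState N) (lam : ℂ) (ψ : LatticeFn) (n : ℤ) (t : ℝ) :
    Prop where
  spectral : todaL S.v S.p ψ n t = lam * ψ n t
  evolution : HasDerivAt (ψ n)
    (-(S.v (n + 1) t * ψ (n + 1) t
      + ∑ j, 1 / (lam - S.ev j) * (S.v (n + 1) t * S.minus j n t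
          * (S.plus j (n + 1) t * ψ n t - S.plus j n t * ψ (n + 1) t)))) t

/-- `x_t = p + ∑_j φ_{j+}φ_{j-}` at `(n,t)`. -/
def MomentumAt (S : TodaState N) (n : ℤ) (t : ℝ) : Prop :=
  HasDerivAt (S.x n) (S.p n t + ∑ j, S.plus j n t * S.minus j n t) t

/-- `v = exp(x^{(-1)} - x)` at `(n,t)`. -/
def ExpAt (S : TodaState N) (n : ℤ) (t : ℝ) : Prop :=
  S.v n t = Complex.exp (S.x (n - 1) t - S.x n t)

/-- The second-order equation for `x`, at `(n,t)`:
`x_tt = exp(x^{(-1)} - x)(1 + ∑ φ_{j+}φ_{j-}^{(-1)}) - exp(x - x^{(1)})(1 + ∑ φ_{j+}^{(1)}φ_{j-})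
  + ∑ (φ_{j+}φ_{j-})_t`. -/
structure SolvesODEAt (S : TodaState N) (n : ℤ) (t : ℝ) : Prop where
  x_diff : ∀ᶠ s in nhds t, DifferentiableAt ℝ (S.x n) s
  source_diff : ∀ j, DifferentiableAt ℝ (fun s => S.plus j n s * S.minus j n s) t
  eq : HasDerivAt (deriv (S.x n))
    (Complex.exp (S.x (n - 1) t - S.x n t) * (1 + ∑ j, S.plus j n t * S.minus j (n - 1) t)
      - Complex.exp (S.x n t - S.x (n + 1) t) * (1 + ∑ j, S.plus j (n + 1) t * S.minus j n t)
      + ∑ j, deriv (fun s => S.plus j n s * S.minus j n s) t) t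

/-- A solution of the Toda lattice with self-consistent sources on all of `ℤ × ℝ`, in both forms:
the system for `v, p, φ_±`, and the equation for `x`, where `v = exp(x^{(-1)} - x)` and
`p = x_t - ∑ φ_{j+}φ_{j-}`. -/
def IsSolution (S : TodaState N) : Prop :=
  ∀ n t, S.SolvesTLSCSAt n t ∧ S.ExpAt n t ∧ S.MomentumAt n t ∧ S.SolvesODEAt n t

end TodaState

/-- `S(φ,h) = Δ⁻¹E(φh) + (μ - lam)⁻¹ [v^{(1)}h^{(1)}φ - hφ^{(1)}]_{n=0}`. -/
noncomputable def sourceSum (v : LatticeFn) (lam : ℂ) (φ : LatticeFn) (μ : ℂ) (h : LatticeFn) :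
    LatticeFn := fun n t =>
  invDelta (fun m s => φ (m + 1) s * h (m + 1) s) n t
    + (μ - lam)⁻¹ * (v 1 t * h 1 t * φ 0 t - h 0 t * φ 1 t)

/-- The data of one Darboux step: a spectral parameter `μ`, functions `f, g` (two eigenfunctions
at `μ`), and the time functions `α, c, d`. -/
structure DarbouxSeed where
  mu : ℂ
  f : LatticeFn
  g : LatticeFn
  α : ℝ → ℂ
  c : ℝ → ℂ
  d : ℝ → ℂ

/-- `h = f + α(t) g`. -/
def DarbouxSeed.h (D : DarbouxSeed) : LatticeFn := fun n t => D.f n t + D.α t * D.g n t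

section OneStep

/-- One forward Darboux transformation of an eigenfunction: `ψ - (h / h^{(1)}) ψ^{(1)}`. -/
noncomputable def fdtEigen (h ψ : LatticeFn) : LatticeFn := fun n t =>
  ψ n t - h n t / h (n + 1) t * ψ (n + 1) t

/-- One forward Darboux transformation, generated by `h` at the spectral parameter `μ`. The old
sources are transformed, and the source
`c (f - (h / h^{(1)}) f^{(1)})`, `d / h` with eigenvalue `μ` is added as the last one. -/
noncomputable def TodaState.fdt {N : ℕ} (S : TodaState N) (μ : ℂ) (f h : LatticeFn)
    (c d : ℝ → ℂ) : TodaState (N + 1) where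
  v := fun n t => S.v (n + 1) t * (h (n + 1) t * h (n - 1) t / h n t ^ 2)
  p := fun n t => S.p n t - h n t / h (n + 1) t + h (n - 1) t / h n t
  x := fun n t => S.x (n + 1) t + 1 / 2 * Complex.log ((h n t / h (n + 1) t) ^ 2)
  plus := Fin.snoc (α := fun _ => LatticeFn) (fun i => fdtEigen h (S.plus i))
    (fun n t => c t * fdtEigen h f n t)
  minus := Fin.snoc (α := fun _ => LatticeFn)
    (fun i n t => sourceSum S.v (S.ev i) (S.minus i) μ h n t / h n t)
    (fun n t => d t * (1 / h n t))
  ev := Fin.snoc (α := fun _ => ℂ) S.ev μ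

end OneStep

section Repeated

/-- The eigenfunction `ψ` after `l` forward Darboux transformations generated successively by
`h_1, …, h_l`: the step number `k` uses `h_k` as transformed by the previous steps. -/
noncomputable def repeatedEigen : (l : ℕ) → (Fin l → LatticeFn) → LatticeFn → LatticeFn
  | 0, _, ψ => ψ
  | l + 1, h, ψ =>
      fdtEigen (repeatedEigen l (fun i => h i.castSucc) (h (Fin.last l)))
        (repeatedEigen l (fun i => h i.castSucc) ψ)

/-- The `l`-times repeated forward Darboux transformation: in the step number `k` the functions
`f_k` and `h_k`, as transformed by the previous steps, generate the transformation. -/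
noncomputable def TodaState.repeatedFDT {N : ℕ} (S : TodaState N) :
    (l : ℕ) → (Fin l → DarbouxSeed) → TodaState (N + l)
  | 0, _ => S
  | l + 1, D =>
      (S.repeatedFDT l (fun i => D i.castSucc)).fdt (D (Fin.last l)).mu
        (repeatedEigen l (fun i => (D i.castSucc).h) (D (Fin.last l)).f)
        (repeatedEigen l (fun i => (D i.castSucc).h) (D (Fin.last l)).h)
        (D (Fin.last l)).c (D (Fin.last l)).d

end Repeated

section Casorati

variable {l : ℕ}

/-- The Casorati determinant `cas(h_1,…,h_l) = det (h_i^{(j)})`, `j = 0, …, l-1`. -/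
noncomputable def cas (h : Fin l → LatticeFn) : LatticeFn := fun n t =>
  Matrix.det (Matrix.of fun i j : Fin l => h i (n + ((j : ℕ) : ℤ)) t)

/-- The Casorati determinant with shifts `j = 0, 2, 3, …, l`. -/
noncomputable def wcas (h : Fin l → LatticeFn) : LatticeFn := fun n t =>
  Matrix.det (Matrix.of fun i j : Fin l =>
    h i (n + (if (j : ℕ) = 0 then 0 else ((j : ℕ) : ℤ) + 1)) t)

/-- The determinant with first row `S(h_1), …, S(h_l)` and further rows
`h_1^{(k)}, …, h_l^{(k)}`, `k = 1, …, l-1`. -/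
noncomputable def bcas (Sh h : Fin l → LatticeFn) : LatticeFn := fun n t =>
  Matrix.det (Matrix.of fun k j : Fin l =>
    if (k : ℕ) = 0 then Sh j n t else h j (n + ((k : ℕ) : ℤ)) t)

/-- `cas(ψ, h_1, …, h_l)`. -/
noncomputable def casCons (ψ : LatticeFn) (h : Fin l → LatticeFn) : LatticeFn :=
  cas (Fin.cons (α := fun _ => LatticeFn) ψ h)

/-- `cas(h_1, …, ĥ_j, …, h_l)`, the function `h_j` being removed. -/
noncomputable def casOmit : {l : ℕ} → (Fin l → LatticeFn) → Fin l → LatticeFn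
  | 0, _, j => j.elim0
  | _ + 1, h, j => cas (fun i => h (j.succAbove i))

/-- The transformed eigenfunction `ψ[l] = cas(ψ,h_1,…,h_l) / cas(h_1,…,h_l)^{(1)}`. -/
noncomputable def casEigen (h : Fin l → LatticeFn) (ψ : LatticeFn) : LatticeFn := fun n t =>
  casCons ψ h n t / cas h (n + 1) t

/-- The square `[cas(h_1,…,h_l) / cas(h_1,…,h_l)^{(1)}]²`, whose logarithm enters `x[l]`. -/
noncomputable def casRatioSq (h : Fin l → LatticeFn) : LatticeFn := fun n t =>
  (cas h n t / cas h (n + 1) t) ^ 2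

/-- The fields `v[l]`, `p[l]`, `x[l]`, `φ_{i±}[l]`, `λ_i` (`i = 1, …, N + l`) given by the
Casorati determinant formulas. The argument `y` is the chosen logarithm of
`[cas / cas^{(1)}]²`. -/
noncomputable def TodaState.casoratiFDT {N : ℕ} (S : TodaState N) (D : Fin l → DarbouxSeed)
    (y : LatticeFn) : TodaState (N + l) where
  v := fun n t => S.v (n + (l : ℤ)) t *
    (cas (fun j => (D j).h) (n + 1) t * cas (fun j => (D j).h) (n - 1) t
      / cas (fun j => (D j).h) n t ^ 2)
  p := fun n t => S.p n t
    + wcas (fun j => (D j).h) (n - 1) t / cas (fun j => (D j).h) n t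
    - wcas (fun j => (D j).h) n t / cas (fun j => (D j).h) (n + 1) t
  x := fun n t => S.x (n + (l : ℤ)) t + 1 / 2 * y n t
  plus := Fin.append
    (fun i n t => casCons (S.plus i) (fun k => (D k).h) n t / cas (fun k => (D k).h) (n + 1) t)
    (fun j n t => (D j).c t *
      (casCons (D j).f (fun k => (D k).h) n t / cas (fun k => (D k).h) (n + 1) t))
  minus := Fin.append
    (fun i n t =>
      bcas (fun k => sourceSum S.v (S.ev i) (S.minus i) (D k).mu (D k).h) (fun k => (D k).h) n t
        / cas (fun k => (D k).h) n t)
    (fun j n t => (D j).d t *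
      (casOmit (fun k => (D k).h) j (n + 1) t / cas (fun k => (D k).h) n t))
  ev := Fin.append S.ev (fun j => (D j).mu)

end Casorati

/-- Near the time `t`, `y` is a continuous branch of `log w`. For real `w > 0` the ordinary real
logarithm is one; for nonvanishing continuous `w` such branches always exist. -/
def IsLogBranchAt (y w : ℝ → ℂ) (t : ℝ) : Prop :=
  ∀ᶠ s in nhds t, ContinuousAt y s ∧ Complex.exp (y s) = w s

section

open Finset

/-! At a fixed time let T be `darbouxOp h`, the difference operator of order l with zeroth
coefficient 1 that annihilates h_1, …, h_l. By Cramer's rule Tψ is the Casorati quotient ψ[l]. The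
last coefficient of T is ±cas/cas^{(1)} and corrects v^{(l)} and x^{(l)}; the coefficient of the
first shift corrects p. The adjoint functions come from the dual sequences u_j (`dualSeq`): up to
sign and the factor d_j they are φ_{N+j,-}[l], and φ_{i-}[l] = Σ_j u_j S_i(h_j), where telescoping
gives S_i(h) = W(φ_{i-}, h)/(μ - λ_i) with W the bilinear form `adjCas`.

The algebra rests on one device. At a site n choose β with ψ = Σ β_j h_j at n+1, …, n+l. T does not
see the combination, and the remainder ψ - Σ β_j h_j vanishes inside the window, so identities for T
reduce to boundary terms. The duals are used in the same way. This gives the new spectral problem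
(`darbouxOp_spectral`, `dualSeq_spectral`), the value of β in terms of the duals
(`Interpolates.sub_eigenvalue_mul`) and the transformation law of W (`Interpolates.casV_mul_sub`).

For the time dependence, an eigenfunction evolves by ψ_t = -v^{(1)}ψ^{(1)} + Σ φ_{i+} S_i(ψ) - kψ
with k independent of n. As α̇ g = (α̇/α)(h - f), each h_j obeys the same law with a shifted k and
an extra term -(α̇_j/α_j) f_j, from which the added sources arise. Differentiating T h_j = 0 and
pairing with duals gives the derivatives of the last coefficient (hence of v and x) and of the first
(hence of p). W is preserved for the old sources and vanishes for the added ones, which puts these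
derivatives in the form of the Toda equations.

Repetition: T for k+1 generators is one Darboux step after T for k generators (`darbouxOp_succ`), so
the determinant formulas follow by induction. For the adjoint sources the induction step is
`Interpolates.casV_mul_sub` and `Interpolates.sub_eigenvalue_mul` applied to the last generator. -/

/-- The Casorati determinant `det (h_i(n+j))` of sequences. -/
noncomputable def seqCas {l : ℕ} (h : Fin l → ℤ → ℂ) (n : ℤ) : ℂ :=
  (Matrix.of fun i j : Fin l => h i (n + ((j : ℕ) : ℤ))).det

/-- The coefficient of the `k`-th shift in the Darboux operator with kernel spanned by `h`. -/
noncomputable def darbouxCoeff {l : ℕ} (h : Fin l → ℤ → ℂ) (n : ℤ) (k : Fin (l + 1)) : ℂ :=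
  (-1) ^ (k : ℕ) *
    (Matrix.of fun i j : Fin l => h i (n + (((k.succAbove j : Fin (l + 1)) : ℕ) : ℤ))).det
    / seqCas h (n + 1)

/-- The Darboux operator with kernel spanned by `h`, normalised to have leading coefficient `1`. -/
noncomputable def darbouxOp {l : ℕ} (h : Fin l → ℤ → ℂ) (ψ : ℤ → ℂ) (n : ℤ) : ℂ :=
  ∑ k, darbouxCoeff h n k * ψ (n + ((k : ℕ) : ℤ))

/-- The sequences dual to `h`: `∑ j, dualSeq h n j * h j (n + k) = δ_{k0}` for `0 ≤ k ≤ m`. -/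
noncomputable def dualSeq {m : ℕ} (h : Fin (m + 1) → ℤ → ℂ) (n : ℤ) (j : Fin (m + 1)) : ℂ :=
  (Matrix.of fun i j : Fin (m + 1) => h i (n + ((j : ℕ) : ℤ)))⁻¹ 0 j

/-! ### The difference operator annihilating the generators -/

section Shifts

variable {l : ℕ} (h : Fin l → ℤ → ℂ) (n : ℤ)

theorem darbouxCoeff_zero (hn : seqCas h (n + 1) ≠ 0) : darbouxCoeff h n 0 = 1 := by
  rw [darbouxCoeff, div_eq_one_iff_eq hn]
  simp only [Fin.val_zero, pow_zero, one_mul, seqCas, Fin.succAbove_zero, Fin.val_succ]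
  congr 2
  ext i j
  congr 1
  push_cast
  ring

theorem darbouxCoeff_last :
    darbouxCoeff h n (Fin.last l) = (-1) ^ l * seqCas h n / seqCas h (n + 1) := by
  simp [darbouxCoeff, seqCas]

theorem darbouxOp_eq_det (ψ : ℤ → ℂ) :
    darbouxOp h ψ n = seqCas (Fin.cons (α := fun _ => ℤ → ℂ) ψ h) n / seqCas h (n + 1) := by
  rw [darbouxOp, seqCas, Matrix.det_succ_row_zero, sum_div]
  refine sum_congr rfl fun k _ => ?_
  simp only [darbouxCoeff, Matrix.of_apply, Fin.cons_zero]
  have : (Matrix.of fun i j : Fin (l + 1) =>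
      (Fin.cons (α := fun _ => ℤ → ℂ) ψ h : Fin (l + 1) → ℤ → ℂ) i
        (n + ((j : ℕ) : ℤ))).submatrix Fin.succ k.succAbove
      = Matrix.of fun i j : Fin l => h i (n + (((k.succAbove j : Fin (l + 1)) : ℕ) : ℤ)) := by
    ext i j
    simp
  rw [this]
  ring

theorem darbouxOp_self (j : Fin l) : darbouxOp h (h j) n = 0 := by
  rw [darbouxOp_eq_det, seqCas,
    Matrix.det_zero_of_row_eq (i := 0) (j := j.succ) (Fin.succ_ne_zero j).symm, zero_div]
  ext k
  simp

theorem darbouxOp_add (ψ χ : ℤ → ℂ) :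
    darbouxOp h (fun i => ψ i + χ i) n = darbouxOp h ψ n + darbouxOp h χ n := by
  simp only [darbouxOp, mul_add, sum_add_distrib]

theorem darbouxOp_sub (ψ χ : ℤ → ℂ) :
    darbouxOp h (fun i => ψ i - χ i) n = darbouxOp h ψ n - darbouxOp h χ n := by
  simp only [darbouxOp, mul_sub, sum_sub_distrib]

theorem darbouxOp_const_mul (c : ℂ) (ψ : ℤ → ℂ) :
    darbouxOp h (fun i => c * ψ i) n = c * darbouxOp h ψ n := by
  simp only [darbouxOp, mul_sum]
  exact sum_congr rfl fun _ _ => by ring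

theorem darbouxOp_sum {ι : Type*} (s : Finset ι) (ψ : ι → ℤ → ℂ) :
    darbouxOp h (fun i => ∑ a ∈ s, ψ a i) n = ∑ a ∈ s, darbouxOp h (ψ a) n := by
  simp only [darbouxOp, mul_sum]
  exact sum_comm

theorem darbouxOp_sum_const_mul {ι : Type*} (s : Finset ι) (c : ι → ℂ) (ψ : ι → ℤ → ℂ) :
    darbouxOp h (fun i => ∑ a ∈ s, c a * ψ a i) n = ∑ a ∈ s, c a * darbouxOp h (ψ a) n := by
  rw [darbouxOp_sum]
  exact sum_congr rfl fun a _ => darbouxOp_const_mul h n (c a) (ψ a)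

theorem darbouxOp_congr {ψ χ : ℤ → ℂ} (hψ : ∀ i, n ≤ i → i ≤ n + l → ψ i = χ i) :
    darbouxOp h ψ n = darbouxOp h χ n := by
  refine sum_congr rfl fun k _ => ?_
  rw [hψ _ (by omega) (by omega)]

/-- Interpolation: the values of `ψ` at `n+1, …, n+l` are those of a combination of the `h j`. -/
theorem exists_interpolation (ψ : ℤ → ℂ) (hn : seqCas h (n + 1) ≠ 0) :
    ∃ β : Fin l → ℂ, ∀ i, n < i → i ≤ n + l → ∑ j, β j * h j i = ψ i := by
  set M := Matrix.of fun i j : Fin l => h i (n + 1 + ((j : ℕ) : ℤ)) with hM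
  have hdet : IsUnit M.det := isUnit_iff_ne_zero.2 hn
  refine ⟨Matrix.vecMul (fun k : Fin l => ψ (n + 1 + ((k : ℕ) : ℤ))) M⁻¹, fun i hi hi' => ?_⟩
  have key := congrFun (Matrix.vecMul_vecMul (fun k : Fin l => ψ (n + 1 + ((k : ℕ) : ℤ))) M⁻¹ M)
    ⟨(i - n - 1).toNat, by omega⟩
  rw [Matrix.nonsing_inv_mul _ hdet, Matrix.vecMul_one] at key
  have e : n + 1 + (((i - n - 1).toNat : ℕ) : ℤ) = i := by omega
  simp only [Matrix.vecMul, dotProduct, hM, Matrix.of_apply, e] at key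
  exact key

/-- The uniqueness half of interpolation. Identities between coefficients indexed by the generators
are proved by testing them against the `h j` on a window of `l` sites with nonzero Casorati
determinant. -/
theorem eq_zero_of_sum_mul_eq_zero (X : Fin l → ℂ) (hn : seqCas h n ≠ 0)
    (hX : ∀ i, n ≤ i → i < n + l → ∑ j, X j * h j i = 0) (j : Fin l) : X j = 0 := by
  have := Matrix.eq_zero_of_vecMul_eq_zero (M := Matrix.of fun i j : Fin l =>
    h i (n + ((j : ℕ) : ℤ))) hn (v := X) (by
      ext k
      simpa [Matrix.vecMul, dotProduct] using hX (n + ((k : ℕ) : ℤ)) (by omega) (by omega))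
  exact congrFun this j

/-- The operator does not see the subtracted combination, and within the window the remainder lives
only at `n`, where the coefficient is 1. -/
theorem darbouxOp_eq_of_interpolation {ψ : ℤ → ℂ} {β : Fin l → ℂ} (hn : seqCas h (n + 1) ≠ 0)
    (hβ : ∀ i, n < i → i ≤ n + l → ∑ j, β j * h j i = ψ i) :
    darbouxOp h ψ n = ψ n - ∑ j, β j * h j n := by
  have h1 : darbouxOp h (fun i => ψ i - ∑ j, β j * h j i) n = darbouxOp h ψ n := by
    rw [darbouxOp_sub, darbouxOp_sum_const_mul]
    simp [darbouxOp_self]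
  rw [← h1, darbouxOp, Fin.sum_univ_succ, darbouxCoeff_zero h n hn]
  refine (congrArg (_ + ·) (sum_eq_zero fun k _ => ?_)).trans (by simp)
  rw [hβ _ (by simp) (by simp), sub_self, mul_zero]

end Shifts

/-! ### Sums over a window of `m + 2` sites with one or two surviving terms -/

section Sums

variable {m : ℕ} (c : Fin (m + 2) → ℂ) (F : ℤ → ℂ) (n : ℤ)

theorem sum_shift_eq_first_add_last (hF : ∀ i, n < i → i < n + m + 1 → F i = 0) :
    ∑ k, c k * F (n + ((k : ℕ) : ℤ)) = c 0 * F n + c (Fin.last (m + 1)) * F (n + m + 1) := by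
  rw [Fin.sum_univ_succ, Fin.sum_univ_castSucc, sum_eq_zero]
  · simp [add_assoc]
  · intro k _
    rw [hF _ (by simp) (by simp), mul_zero]

theorem sum_shift_eq_last (hF : ∀ i, n ≤ i → i < n + m + 1 → F i = 0) :
    ∑ k, c k * F (n + ((k : ℕ) : ℤ)) = c (Fin.last (m + 1)) * F (n + m + 1) := by
  rw [sum_shift_eq_first_add_last c F n fun i hi => hF i hi.le, hF n le_rfl (by omega)]
  simp

theorem sum_shift_eq_two (hF : ∀ i, n + 1 < i → i ≤ n + m + 1 → F i = 0) :
    ∑ k, c k * F (n + ((k : ℕ) : ℤ)) = c 0 * F n + c 1 * F (n + 1) := by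
  rw [Fin.sum_univ_succ, Fin.sum_univ_succ, sum_eq_zero]
  · simp
  · intro k _
    rw [hF _ (by simp) (by simp; omega), mul_zero]

end Sums

/-! ### The sequences dual to the generators -/

section Dual

variable {m : ℕ} (h : Fin (m + 1) → ℤ → ℂ) {n : ℤ}

theorem sum_dualSeq_mul_shift (hn : seqCas h n ≠ 0) (k : Fin (m + 1)) :
    ∑ j, dualSeq h n j * h j (n + ((k : ℕ) : ℤ)) = if k = 0 then 1 else 0 := by
  set M := Matrix.of fun i j : Fin (m + 1) => h i (n + ((j : ℕ) : ℤ)) with hM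
  have hdet : IsUnit M.det := isUnit_iff_ne_zero.2 hn
  have key := congrFun (congrFun (Matrix.nonsing_inv_mul M hdet) 0) k
  rw [Matrix.mul_apply, Matrix.one_apply] at key
  simpa [eq_comm, dualSeq, hM] using key

theorem sum_dualSeq_mul_self (hn : seqCas h n ≠ 0) : ∑ j, dualSeq h n j * h j n = 1 := by
  simpa using sum_dualSeq_mul_shift h hn 0

theorem sum_dualSeq_mul_eq_zero (hn : seqCas h n ≠ 0) {i : ℤ} (hi : n < i) (hi' : i < n + m + 1) :
    ∑ j, dualSeq h n j * h j i = 0 := by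
  have := sum_dualSeq_mul_shift h hn ⟨(i - n).toNat, by omega⟩
  rw [if_neg (by simp [Fin.ext_iff]; omega)] at this
  rwa [show n + (((⟨(i - n).toNat, by omega⟩ : Fin (m + 1)) : ℕ) : ℤ) = i by simp; omega] at this

/-- The Darboux operator annihilates combinations of the `h j`. -/
theorem sum_darbouxCoeff_mul_combination {l : ℕ} (h : Fin l → ℤ → ℂ) (n : ℤ) (β : Fin l → ℂ) :
    ∑ k, darbouxCoeff h n k * ∑ j, β j * h j (n + ((k : ℕ) : ℤ)) = 0 := by
  have := darbouxOp_sum_const_mul h n univ β h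
  simp only [darbouxOp_self, mul_zero, sum_const_zero] at this
  exact this

/-- The combination of generators with coefficients `dualSeq h n` is 1 at `n` and 0 at the next `m`
sites, so its annihilation at `n` relates only the first and last coefficients. -/
theorem darbouxCoeff_last_mul_sum_dualSeq (hn : seqCas h n ≠ 0) (hn' : seqCas h (n + 1) ≠ 0) :
    darbouxCoeff h n (Fin.last (m + 1)) * ∑ j, dualSeq h n j * h j (n + m + 1) = -1 := by
  have := sum_darbouxCoeff_mul_combination h n (dualSeq h n)
  rw [sum_shift_eq_first_add_last _ (fun i => ∑ j, dualSeq h n j * h j i) n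
    fun i => sum_dualSeq_mul_eq_zero h hn, darbouxCoeff_zero h n hn', sum_dualSeq_mul_self h hn]
    at this
  linear_combination this

/-- The same combination, annihilated by the operator at `n - 1`: that window meets it only at `n -
1` and `n`. -/
theorem sum_dualSeq_mul_pred (hn : seqCas h n ≠ 0) :
    ∑ j, dualSeq h n j * h j (n - 1) = -darbouxCoeff h (n - 1) 1 := by
  have := sum_darbouxCoeff_mul_combination h (n - 1) (dualSeq h n)
  rw [sum_shift_eq_two _ (fun i => ∑ j, dualSeq h n j * h j i) (n - 1)
    fun i hi hi' => sum_dualSeq_mul_eq_zero h hn (by omega) (by omega),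
    darbouxCoeff_zero h _ (by simpa using hn), sub_add_cancel, sum_dualSeq_mul_self h hn] at this
  linear_combination this

theorem darbouxCoeff_last_ne_zero (hn : seqCas h n ≠ 0) (hn' : seqCas h (n + 1) ≠ 0) :
    darbouxCoeff h n (Fin.last (m + 1)) ≠ 0 := fun h0 => by
  have := darbouxCoeff_last_mul_sum_dualSeq h hn hn'
  simp [h0] at this

theorem sum_dualSeq_mul_top (hn : seqCas h n ≠ 0) (hn' : seqCas h (n + 1) ≠ 0) :
    ∑ j, dualSeq h n j * h j (n + m + 1) = -(darbouxCoeff h n (Fin.last (m + 1)))⁻¹ := by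
  have h0 := darbouxCoeff_last_ne_zero h hn hn'
  have := darbouxCoeff_last_mul_sum_dualSeq h hn hn'
  field_simp
  linear_combination this

end Dual

/-- The field `v` after the Darboux transformation with kernel spanned by `h`. -/
noncomputable def casV {m : ℕ} (v : ℤ → ℂ) (h : Fin (m + 1) → ℤ → ℂ) (n : ℤ) : ℂ :=
  v (n + ((m + 1 : ℕ) : ℤ)) * (seqCas h (n + 1) * seqCas h (n - 1) / seqCas h n ^ 2)

/-- The field `p` after the Darboux transformation with kernel spanned by `h`. -/
noncomputable def casP {m : ℕ} (p : ℤ → ℂ) (h : Fin (m + 1) → ℤ → ℂ) (n : ℤ) : ℂ :=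
  p n + darbouxCoeff h n 1 - darbouxCoeff h (n - 1) 1

/-! ### Covariance of the spectral problem and of its adjoint -/

section Spectral

variable {m : ℕ} {h : Fin (m + 1) → ℤ → ℂ} {v p : ℤ → ℂ} {μ : Fin (m + 1) → ℂ} {n : ℤ}

/-- With a(n) the last coefficient this is v[l](n) = v(n+l) a(n-1)/a(n), the form used both for the
boundary terms and for the time derivative of v[l]. -/
theorem casV_mul_darbouxCoeff_last (hn : seqCas h n ≠ 0) (hn' : seqCas h (n + 1) ≠ 0) :
    casV v h n * darbouxCoeff h n (Fin.last (m + 1))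
      = v (n + m + 1) * darbouxCoeff h (n - 1) (Fin.last (m + 1)) := by
  rw [casV, darbouxCoeff_last, darbouxCoeff_last, sub_add_cancel]
  push_cast
  rw [← add_assoc]
  field_simp

theorem darbouxOp_sub_combination (ψ : ℤ → ℂ) (β : Fin (m + 1) → ℂ) (i : ℤ) :
    darbouxOp h (fun i => ψ i - ∑ j, β j * h j i) i = darbouxOp h ψ i := by
  rw [darbouxOp_sub, darbouxOp_sum_const_mul]
  simp [darbouxOp_self]

/-- `β` interpolates `ψ` by the `h j` at the sites `n + 1, …, n + m + 1`. -/
def Interpolates (h : Fin (m + 1) → ℤ → ℂ) (n : ℤ) (ψ : ℤ → ℂ) (β : Fin (m + 1) → ℂ) : Prop :=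
  ∀ i, n < i → i ≤ n + m + 1 → ∑ j, β j * h j i = ψ i

theorem exists_interpolates (ψ : ℤ → ℂ) (hn : seqCas h (n + 1) ≠ 0) :
    ∃ β, Interpolates h n ψ β := by
  obtain ⟨β, hβ⟩ := exists_interpolation h n ψ hn
  exact ⟨β, fun i hi hi' => hβ i hi (by push_cast; omega)⟩

theorem Interpolates.darbouxOp_eq {ψ : ℤ → ℂ} {β : Fin (m + 1) → ℂ} (hβ : Interpolates h n ψ β)
    (hn : seqCas h (n + 1) ≠ 0) : darbouxOp h ψ n = ψ n - ∑ j, β j * h j n :=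
  darbouxOp_eq_of_interpolation h n hn fun i hi hi' => hβ i hi (by push_cast at hi'; omega)

/-- The window based at `n + 1` reaches one site beyond the interpolated ones, so only its last term
survives. -/
theorem Interpolates.casV_mul_darbouxOp_succ {ψ : ℤ → ℂ} {β : Fin (m + 1) → ℂ}
    (hβ : Interpolates h n ψ β) (h1 : seqCas h (n + 1) ≠ 0) (h2 : seqCas h (n + 2) ≠ 0) :
    casV v h (n + 1) * darbouxOp h ψ (n + 1)
      = darbouxCoeff h n (Fin.last (m + 1)) * (v (n + m + 1 + 1)
        * (ψ (n + m + 1 + 1) - ∑ j, β j * h j (n + m + 1 + 1))) := by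
  rw [← darbouxOp_sub_combination ψ β, darbouxOp, sum_shift_eq_last _
    (fun i => ψ i - ∑ j, β j * h j i) (n + 1)
    fun i hi hi' => by rw [hβ i (by omega) (by omega), sub_self]]
  have := casV_mul_darbouxCoeff_last (v := v) h1 (by rwa [add_assoc])
  rw [add_sub_cancel_right] at this
  rw [show n + 1 + m + 1 = n + m + 1 + 1 by ring] at *
  linear_combination (ψ (n + m + 1 + 1) - ∑ j, β j * h j (n + m + 1 + 1)) * this

variable (hL : ∀ j i, v (i + 1) * h j (i + 1) + p i * h j i + h j (i - 1) = μ j * h j i)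
include hL

theorem sum_eigenvalue_mul (β : Fin (m + 1) → ℂ) (i : ℤ) :
    v (i + 1) * (∑ j, β j * h j (i + 1)) + p i * (∑ j, β j * h j i) + ∑ j, β j * h j (i - 1)
      = ∑ j, μ j * β j * h j i := by
  simp only [mul_sum, ← sum_add_distrib]
  exact sum_congr rfl fun j _ => by linear_combination β j * hL j i

/-- Apply the operator at `n` to λψ - Σ μ_j β_j h_j = L(ψ - Σ β_j h_j). On the left the generators
are annihilated; on the right the remainder vanishes inside the window, and the boundary values left
by the three terms of L are expressible by Tψ at n-1, n, n+1. -/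
theorem darbouxOp_spectral {ψ : ℤ → ℂ} {lam : ℂ}
    (hψ : ∀ i, v (i + 1) * ψ (i + 1) + p i * ψ i + ψ (i - 1) = lam * ψ i)
    (h0 : seqCas h n ≠ 0) (h1 : seqCas h (n + 1) ≠ 0) (h2 : seqCas h (n + 2) ≠ 0) :
    casV v h (n + 1) * darbouxOp h ψ (n + 1) + casP p h n * darbouxOp h ψ n
      + darbouxOp h ψ (n - 1) = lam * darbouxOp h ψ n := by
  obtain ⟨β, hβ⟩ := exists_interpolates (n := n) ψ h1
  have hG : ∀ i, n < i → i ≤ n + m + 1 → ψ i - ∑ j, β j * h j i = 0 := fun i hi hi' => by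
    rw [hβ i hi hi', sub_self]
  have e1 := hβ.casV_mul_darbouxOp_succ (v := v) h1 h2
  have e0 := hβ.darbouxOp_eq h1
  have e2 : darbouxOp h ψ (n - 1) = ψ (n - 1) - (∑ j, β j * h j (n - 1))
      + darbouxCoeff h (n - 1) 1 * darbouxOp h ψ n := by
    rw [e0, ← darbouxOp_sub_combination ψ β, darbouxOp, sum_shift_eq_two _
      (fun i => ψ i - ∑ j, β j * h j i) (n - 1) fun i hi hi' => hG i (by omega) (by omega),
      darbouxCoeff_zero h _ (by simpa using h0)]
    simp
  have e3 : lam * darbouxOp h ψ n = darbouxOp h (fun i =>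
      v (i + 1) * (ψ (i + 1) - ∑ j, β j * h j (i + 1)) + p i * (ψ i - ∑ j, β j * h j i)
        + (ψ (i - 1) - ∑ j, β j * h j (i - 1))) n := by
    have : (fun i => v (i + 1) * (ψ (i + 1) - ∑ j, β j * h j (i + 1))
        + p i * (ψ i - ∑ j, β j * h j i) + (ψ (i - 1) - ∑ j, β j * h j (i - 1)))
        = fun i => lam * ψ i - ∑ j, μ j * β j * h j i := by
      funext i
      linear_combination hψ i - sum_eigenvalue_mul hL β i
    rw [this, darbouxOp_sub, darbouxOp_sum_const_mul, darbouxOp_const_mul]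
    simp [darbouxOp_self]
  rw [darbouxOp_add, darbouxOp_add] at e3
  have e4 : darbouxOp h (fun i => v (i + 1) * (ψ (i + 1) - ∑ j, β j * h j (i + 1))) n
      = casV v h (n + 1) * darbouxOp h ψ (n + 1) := by
    rw [e1, darbouxOp, sum_shift_eq_last _
      (fun i => v (i + 1) * (ψ (i + 1) - ∑ j, β j * h j (i + 1))) n fun i hi hi' => by
        rw [hG (i + 1) (by omega) (by omega), mul_zero]]
  have e5 : darbouxOp h (fun i => p i * (ψ i - ∑ j, β j * h j i)) n
      = p n * darbouxOp h ψ n := by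
    rw [e0, darbouxOp, sum_shift_eq_first_add_last _
      (fun i => p i * (ψ i - ∑ j, β j * h j i)) n fun i hi hi' => by
        rw [hG i hi (by omega), mul_zero]]
    rw [hG _ (by omega) le_rfl, darbouxCoeff_zero h _ h1]
    ring
  have e6 : darbouxOp h (fun i => ψ (i - 1) - ∑ j, β j * h j (i - 1)) n
      = ψ (n - 1) - (∑ j, β j * h j (n - 1)) + darbouxCoeff h n 1 * darbouxOp h ψ n := by
    rw [e0, darbouxOp, sum_shift_eq_two _
      (fun i => ψ (i - 1) - ∑ j, β j * h j (i - 1)) n fun i hi hi' =>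
        hG (i - 1) (by omega) (by omega), darbouxCoeff_zero h _ h1]
    simp
  rw [e4, e5, e6] at e3
  rw [e3, casP, e2]
  ring

/-- Tested against the generators at n+1, …, n+m+1. There L of the remainder is nonzero only at the
two ends: the dual based at `n + 1` accounts for the lower end, the dual based at `n` for the upper
one. -/
theorem Interpolates.sub_eigenvalue_mul {ψ : ℤ → ℂ} {lam : ℂ} {β : Fin (m + 1) → ℂ}
    (hβ : Interpolates h n ψ β)
    (hψ : ∀ i, v (i + 1) * ψ (i + 1) + p i * ψ i + ψ (i - 1) = lam * ψ i)
    (h0 : seqCas h n ≠ 0) (h1 : seqCas h (n + 1) ≠ 0) (h2 : seqCas h (n + 2) ≠ 0)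
    (j : Fin (m + 1)) :
    (lam - μ j) * β j = darbouxOp h ψ n * dualSeq h (n + 1) j
      - casV v h (n + 1) * darbouxOp h ψ (n + 1) * dualSeq h n j := by
  rw [← sub_eq_zero]
  refine eq_zero_of_sum_mul_eq_zero h (n + 1) (fun j => (lam - μ j) * β j
    - (darbouxOp h ψ n * dualSeq h (n + 1) j
      - casV v h (n + 1) * darbouxOp h ψ (n + 1) * dualSeq h n j)) h1 (fun i hi hi' => ?_) j
  push_cast at hi'
  have e0 : ∑ j, ((lam - μ j) * β j - (darbouxOp h ψ n * dualSeq h (n + 1) j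
      - casV v h (n + 1) * darbouxOp h ψ (n + 1) * dualSeq h n j)) * h j i
      = lam * ∑ j, β j * h j i - ∑ j, μ j * β j * h j i
        - darbouxOp h ψ n * ∑ j, dualSeq h (n + 1) j * h j i
        + casV v h (n + 1) * darbouxOp h ψ (n + 1) * ∑ j, dualSeq h n j * h j i := by
    simp only [mul_sum, ← sum_add_distrib, ← sum_sub_distrib]
    exact sum_congr rfl fun j _ => by ring
  have hi0 := hβ i (by omega) (by omega)
  have e1 := sum_eigenvalue_mul hL β i
  rw [e0, ← e1, hi0, hβ.casV_mul_darbouxOp_succ h1 h2, hβ.darbouxOp_eq h1]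
  have a0 := darbouxCoeff_last_ne_zero h h0 h1
  have eψ := hψ i
  have eA : darbouxCoeff h n (Fin.last (m + 1)) * (v (n + m + 1 + 1)
        * (ψ (n + m + 1 + 1) - ∑ j, β j * h j (n + m + 1 + 1))) * ∑ j, dualSeq h n j * h j i
      = - (v (i + 1) * (ψ (i + 1) - ∑ j, β j * h j (i + 1))) := by
    rcases eq_or_ne i (n + m + 1) with rfl | hne
    · rw [sum_dualSeq_mul_top h h0 h1]
      field_simp
    · rw [sum_dualSeq_mul_eq_zero h h0 (by omega) (by omega), hβ (i + 1) (by omega) (by omega)]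
      ring
  have eB : (ψ n - ∑ j, β j * h j n) * ∑ j, dualSeq h (n + 1) j * h j i
      = ψ (i - 1) - ∑ j, β j * h j (i - 1) := by
    rcases eq_or_ne i (n + 1) with rfl | hne
    · rw [sum_dualSeq_mul_self h h1]
      simp
    · rw [sum_dualSeq_mul_eq_zero h h1 (by omega) (by omega), hβ (i - 1) (by omega) (by omega)]
      ring
  rw [eA, eB]
  linear_combination -eψ

/-- Tested against the generators at n, …, n+m. Replacing μ_j h_j by L h_j turns everything into
pairings of duals with shifted generators, which are nonzero only near the ends of the window. -/
theorem dualSeq_spectral (hm : seqCas h (n - 1) ≠ 0) (h0 : seqCas h n ≠ 0)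
    (h1 : seqCas h (n + 1) ≠ 0) (j : Fin (m + 1)) :
    casV v h n * dualSeq h (n - 1) j + casP p h n * dualSeq h n j + dualSeq h (n + 1) j
      = μ j * dualSeq h n j := by
  rw [← sub_eq_zero]
  refine eq_zero_of_sum_mul_eq_zero h n (fun j => casV v h n * dualSeq h (n - 1) j
    + casP p h n * dualSeq h n j + dualSeq h (n + 1) j - μ j * dualSeq h n j) h0
    (fun i hi hi' => ?_) j
  push_cast at hi'
  have e0 : ∑ j, (casV v h n * dualSeq h (n - 1) j
      + casP p h n * dualSeq h n j + dualSeq h (n + 1) j - μ j * dualSeq h n j) * h j i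
      = casV v h n * ∑ j, dualSeq h (n - 1) j * h j i + casP p h n * ∑ j, dualSeq h n j * h j i
        + ∑ j, dualSeq h (n + 1) j * h j i - ∑ j, μ j * dualSeq h n j * h j i := by
    simp only [mul_sum, ← sum_add_distrib, ← sum_sub_distrib]
    exact sum_congr rfl fun j _ => by ring
  rw [e0, ← sum_eigenvalue_mul hL (dualSeq h n) i]
  have a0 := darbouxCoeff_last_ne_zero h h0 h1
  have eA : casV v h n * ∑ j, dualSeq h (n - 1) j * h j i
      = v (i + 1) * ∑ j, dualSeq h n j * h j (i + 1) := by
    rcases eq_or_ne i (n + m) with rfl | hne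
    · have e := sum_dualSeq_mul_top h hm (by simpa using h0)
      have a1 := darbouxCoeff_last_ne_zero h hm (by simpa using h0)
      rw [show n - 1 + m + 1 = n + m by ring] at e
      rw [sum_dualSeq_mul_top h h0 h1, e]
      have := casV_mul_darbouxCoeff_last (v := v) h0 h1
      field_simp
      linear_combination -this
    · rw [sum_dualSeq_mul_eq_zero h hm (by omega) (by omega),
        sum_dualSeq_mul_eq_zero h h0 (by omega) (by omega)]
      ring
  have eB : casP p h n * ∑ j, dualSeq h n j * h j i + ∑ j, dualSeq h (n + 1) j * h j i
      = p i * ∑ j, dualSeq h n j * h j i + ∑ j, dualSeq h n j * h j (i - 1) := by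
    rcases eq_or_ne i n with rfl | hne
    · have := sum_dualSeq_mul_pred h h1
      rw [add_sub_cancel_right] at this
      rw [sum_dualSeq_mul_self h h0, sum_dualSeq_mul_pred h h0, this, casP]
      ring
    · rw [sum_dualSeq_mul_eq_zero h h0 (i := i) (by omega) (by omega)]
      rcases eq_or_ne i (n + 1) with rfl | hne'
      · rw [sum_dualSeq_mul_self h h1, add_sub_cancel_right, sum_dualSeq_mul_self h h0]
        ring
      · rw [sum_dualSeq_mul_eq_zero h h1 (by omega) (by omega),
          sum_dualSeq_mul_eq_zero h h0 (by omega) (by omega)]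
        ring
  linear_combination eA + eB

end Spectral

/-! ### Adjoint sources and their potentials -/

/-- The Casorati-type bilinear form of an adjoint eigenfunction `φ` and an eigenfunction `ψ`. -/
def adjCas (v φ ψ : ℤ → ℂ) (n : ℤ) : ℂ := v (n + 1) * ψ (n + 1) * φ n - ψ n * φ (n + 1)

theorem eq_of_forall_eq_pred {D : ℤ → ℂ} {a b : ℤ} (hD : ∀ i, a < i → i ≤ b → D i = D (i - 1)) :
    ∀ i, a ≤ i → i ≤ b → D i = D a := by
  intro i hi
  induction i, hi using Int.leInduction with
  | base => exact fun _ => rfl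
  | succ i hi ih =>
    intro hi'
    rw [hD _ (by omega) hi', add_sub_cancel_right, ih (by omega)]

/-- The discrete Green identity: cross-multiply the two spectral equations. -/
theorem adjCas_sub_pred {v p φ ψ : ℤ → ℂ} {lam κ : ℂ}
    (hφ : ∀ i, v i * φ (i - 1) + p i * φ i + φ (i + 1) = lam * φ i)
    (hψ : ∀ i, v (i + 1) * ψ (i + 1) + p i * ψ i + ψ (i - 1) = κ * ψ i) (i : ℤ) :
    adjCas v φ ψ i - adjCas v φ ψ (i - 1) = (κ - lam) * (φ i * ψ i) := by
  simp only [adjCas, sub_add_cancel]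
  linear_combination φ i * hψ i - ψ i * hφ i

section Source

variable {m : ℕ} {h : Fin (m + 1) → ℤ → ℂ} {φ : ℤ → ℂ} {S : Fin (m + 1) → ℤ → ℂ} {n : ℤ}
  (hS : ∀ j i, S j i - S j (i - 1) = φ i * h j i)
include hS

theorem sum_mul_sub_pred (γ : Fin (m + 1) → ℂ) (i : ℤ) :
    ∑ j, γ j * S j i - ∑ j, γ j * S j (i - 1) = φ i * ∑ j, γ j * h j i := by
  rw [← sum_sub_distrib, mul_sum]
  exact sum_congr rfl fun j _ => by linear_combination γ j * hS j i

/-- The combination Σ_j u_j(n) S_j has increments φ Σ_j u_j(n) h_j, so it is constant on n, …, n+m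
and jumps by a known amount at n+m+1. The constant comes out of the operator and the jump meets only
the last coefficient. -/
theorem sum_dualSeq_mul_darbouxOp_source (χ : ℤ → ℂ)
    (h0 : seqCas h n ≠ 0) (h1 : seqCas h (n + 1) ≠ 0) :
    ∑ j, dualSeq h n j * darbouxOp h (fun i => χ i * S j i) n
      = darbouxOp h χ n * ∑ j, dualSeq h n j * S j n
        - χ (n + m + 1) * φ (n + m + 1) := by
  set D : ℤ → ℂ := fun i => ∑ j, dualSeq h n j * S j i with hD
  have hc : ∀ i, n ≤ i → i ≤ n + m → D i = D n := eq_of_forall_eq_pred fun i hi hi' => by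
    have := sum_mul_sub_pred hS (dualSeq h n) i
    rw [sum_dualSeq_mul_eq_zero h h0 hi (by omega)] at this
    linear_combination this
  have ht := sum_mul_sub_pred hS (dualSeq h n) (n + m + 1)
  rw [add_sub_cancel_right, sum_dualSeq_mul_top h h0 h1] at ht
  have hm := hc (n + m) (by omega) le_rfl
  have e : darbouxOp h (fun i => χ i * (D i - D n)) n
      = darbouxCoeff h n (Fin.last (m + 1)) * (χ (n + m + 1) * (D (n + m + 1) - D n)) := by
    rw [darbouxOp, sum_shift_eq_last _ (fun i => χ i * (D i - D n)) n fun i hi hi' => by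
      rw [hc i hi (by omega), sub_self, mul_zero]]
  have e' : ∑ j, dualSeq h n j * darbouxOp h (fun i => χ i * S j i) n
      = darbouxOp h (fun i => χ i * (D i - D n)) n + D n * darbouxOp h χ n := by
    rw [← darbouxOp_const_mul, ← darbouxOp_add, ← darbouxOp_sum_const_mul]
    congr 1
    funext i
    rw [hD, show χ i * (∑ j, dualSeq h n j * S j i - ∑ j, dualSeq h n j * S j n)
      + (∑ j, dualSeq h n j * S j n) * χ i = χ i * ∑ j, dualSeq h n j * S j i by ring, mul_sum]
    exact sum_congr rfl fun j _ => by ring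
  have a0 := darbouxCoeff_last_ne_zero h h0 h1
  have ht' : D (n + m + 1) - D n = -(φ (n + m + 1) * (darbouxCoeff h n (Fin.last (m + 1)))⁻¹) := by
    have : D (n + m + 1) - D (n + m)
      = φ (n + m + 1) * -(darbouxCoeff h n (Fin.last (m + 1)))⁻¹ := ht
    linear_combination this + hm
  rw [e', e, ht']
  field_simp
  ring

/-- With the duals based at `n + 1` the jump sits at the lower end of the window, where the
coefficient is 1. -/
theorem sum_dualSeq_succ_mul_darbouxOp_source (χ : ℤ → ℂ) (h1 : seqCas h (n + 1) ≠ 0) :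
    ∑ j, dualSeq h (n + 1) j * darbouxOp h (fun i => χ i * S j i) n
      = darbouxOp h χ n * (∑ j, dualSeq h (n + 1) j * S j (n + 1)) - χ n * φ (n + 1) := by
  set D : ℤ → ℂ := fun i => ∑ j, dualSeq h (n + 1) j * S j i with hD
  have hc : ∀ i, n + 1 ≤ i → i ≤ n + 1 + m → D i = D (n + 1) :=
    eq_of_forall_eq_pred fun i hi hi' => by
      have := sum_mul_sub_pred hS (dualSeq h (n + 1)) i
      rw [sum_dualSeq_mul_eq_zero h h1 hi (by omega)] at this
      linear_combination this
  have ht : D (n + 1) - D n = φ (n + 1) := by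
    have := sum_mul_sub_pred hS (dualSeq h (n + 1)) (n + 1)
    rw [add_sub_cancel_right, sum_dualSeq_mul_self h h1, mul_one] at this
    exact this
  have e : darbouxOp h (fun i => χ i * (D i - D (n + 1))) n = χ n * (D n - D (n + 1)) := by
    rw [darbouxOp, sum_shift_eq_first_add_last _ (fun i => χ i * (D i - D (n + 1))) n
      fun i hi hi' => by rw [hc i hi (by omega), sub_self, mul_zero], darbouxCoeff_zero h _ h1,
      hc (n + m + 1) (by omega) (by omega)]
    ring
  have e' : ∑ j, dualSeq h (n + 1) j * darbouxOp h (fun i => χ i * S j i) n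
      = darbouxOp h (fun i => χ i * (D i - D (n + 1))) n + D (n + 1) * darbouxOp h χ n := by
    rw [← darbouxOp_const_mul, ← darbouxOp_add, ← darbouxOp_sum_const_mul]
    congr 1
    funext i
    rw [hD, show χ i * (∑ j, dualSeq h (n + 1) j * S j i
      - ∑ j, dualSeq h (n + 1) j * S j (n + 1)) + (∑ j, dualSeq h (n + 1) j * S j (n + 1)) * χ i
      = χ i * ∑ j, dualSeq h (n + 1) j * S j i by ring, mul_sum]
    exact sum_congr rfl fun j _ => by ring
  rw [e', e]
  linear_combination -χ n * ht

/-- The increments of Sψ - Σ β_j S_j are φ times the interpolation remainder, so it is constant on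
the whole window of the operator at `n`. -/
theorem Interpolates.darbouxOp_source_sub {ψ Sψ : ℤ → ℂ} {β : Fin (m + 1) → ℂ}
    (hβ : Interpolates h n ψ β) (hψ : ∀ i, Sψ i - Sψ (i - 1) = φ i * ψ i) (χ : ℤ → ℂ) :
    darbouxOp h (fun i => χ i * Sψ i) n - ∑ j, β j * darbouxOp h (fun i => χ i * S j i) n
      = darbouxOp h χ n * (Sψ n - ∑ j, β j * S j n) := by
  have hc : ∀ i, n ≤ i → i ≤ n + m + 1 →
      Sψ i - ∑ j, β j * S j i = Sψ n - ∑ j, β j * S j n :=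
    eq_of_forall_eq_pred (D := fun i => Sψ i - ∑ j, β j * S j i) fun i hi hi' => by
      have := sum_mul_sub_pred hS β i
      rw [hβ i hi hi'] at this
      linear_combination hψ i - this
  rw [← darbouxOp_sum_const_mul, ← darbouxOp_sub, mul_comm (darbouxOp h χ n),
    ← darbouxOp_const_mul]
  refine darbouxOp_congr h n fun i hi hi' => ?_
  rw [← hc i hi (by push_cast at hi'; omega), sub_mul, sum_mul, mul_comm (χ i)]
  congr 1
  exact sum_congr rfl fun j _ => by ring

variable {v p : ℤ → ℂ} {μ : Fin (m + 1) → ℂ} {lam : ℂ}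
  (hL : ∀ j i, v (i + 1) * h j (i + 1) + p i * h j i + h j (i - 1) = μ j * h j i)
  (hW : ∀ j i, (μ j - lam) * S j i = adjCas v φ (h j) i)
include hL hW

/-- The left side is the bilinear form of the transformed adjoint source and the transformed `ψ`.
Contract the formula for (κ - μ_j)β_j with S_j; since (κ - lam) - (κ - μ_j) = μ_j - lam, `hW`
converts the difference into bilinear forms of the generators, which interpolation compares with
that of `ψ`. For κ = lam the form is preserved. -/
theorem Interpolates.casV_mul_sub {ψ : ℤ → ℂ} {κ : ℂ} {β : Fin (m + 1) → ℂ}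
    (hβ : Interpolates h n ψ β)
    (hψ : ∀ i, v (i + 1) * ψ (i + 1) + p i * ψ i + ψ (i - 1) = κ * ψ i)
    (h0 : seqCas h n ≠ 0) (h1 : seqCas h (n + 1) ≠ 0) (h2 : seqCas h (n + 2) ≠ 0) :
    casV v h (n + 1) * darbouxOp h ψ (n + 1) * (∑ j, dualSeq h n j * S j n)
      - darbouxOp h ψ n * ∑ j, dualSeq h (n + 1) j * S j (n + 1)
      = adjCas v φ ψ n - (κ - lam) * ∑ j, β j * S j n := by
  have e1 : (∑ j, dualSeq h (n + 1) j * S j (n + 1)) - (∑ j, dualSeq h (n + 1) j * S j n)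
      = φ (n + 1) := by
    have := sum_mul_sub_pred hS (dualSeq h (n + 1)) (n + 1)
    rwa [add_sub_cancel_right, sum_dualSeq_mul_self h h1, mul_one] at this
  have e2 : ∑ j, (κ - μ j) * β j * S j n
      = darbouxOp h ψ n * (∑ j, dualSeq h (n + 1) j * S j n)
        - casV v h (n + 1) * darbouxOp h ψ (n + 1) * ∑ j, dualSeq h n j * S j n := by
    simp only [mul_sum, ← sum_sub_distrib]
    refine sum_congr rfl fun j _ => ?_
    rw [hβ.sub_eigenvalue_mul hL hψ h0 h1 h2 j]
    ring
  have e3 : (κ - lam) * (∑ j, β j * S j n) - ∑ j, (κ - μ j) * β j * S j n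
      = v (n + 1) * (∑ j, β j * h j (n + 1)) * φ n - (∑ j, β j * h j n) * φ (n + 1) := by
    simp only [mul_sum, sum_mul, ← sum_sub_distrib]
    refine sum_congr rfl fun j _ => ?_
    have := hW j n
    rw [adjCas] at this
    linear_combination β j * this
  have e4 := hβ.darbouxOp_eq h1
  rw [hβ (n + 1) (by omega) (by omega)] at e3
  rw [adjCas]
  linear_combination -darbouxOp h ψ n * e1 + e2 + e3 - φ (n + 1) * e4

/-- Multiply the equation of the duals by S_j(n) and sum. Moving S_j to the neighbouring sites costs
increments φ h_j, and these cancel against the bilinear forms coming from (μ_j - lam) S_j. -/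
theorem dualSource_spectral (hm : seqCas h (n - 1) ≠ 0) (h0 : seqCas h n ≠ 0)
    (h1 : seqCas h (n + 1) ≠ 0) :
    casV v h n * (∑ j, dualSeq h (n - 1) j * S j (n - 1))
      + casP p h n * (∑ j, dualSeq h n j * S j n) + ∑ j, dualSeq h (n + 1) j * S j (n + 1)
      = lam * ∑ j, dualSeq h n j * S j n := by
  have e1 := sum_mul_sub_pred hS (dualSeq h (n + 1)) (n + 1)
  rw [add_sub_cancel_right, sum_dualSeq_mul_self h h1, mul_one] at e1
  have e2 := sum_mul_sub_pred hS (dualSeq h (n - 1)) n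
  have e3 : casV v h n * (∑ j, dualSeq h (n - 1) j * S j n)
      + casP p h n * (∑ j, dualSeq h n j * S j n) + ∑ j, dualSeq h (n + 1) j * S j n
      = lam * (∑ j, dualSeq h n j * S j n)
        + (v (n + 1) * (∑ j, dualSeq h n j * h j (n + 1)) * φ n
          - (∑ j, dualSeq h n j * h j n) * φ (n + 1)) := by
    simp only [mul_sum, sum_mul, ← sum_sub_distrib, ← sum_add_distrib]
    refine sum_congr rfl fun j _ => ?_
    have := hW j n
    rw [adjCas] at this
    linear_combination S j n * dualSeq_spectral hL hm h0 h1 j + dualSeq h n j * this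
  have eA : casV v h n * ∑ j, dualSeq h (n - 1) j * h j n
      = v (n + 1) * ∑ j, dualSeq h n j * h j (n + 1) := by
    -- With a single generator both pairings sit at the top of their windows and are nonzero;
    -- otherwise both vanish.
    rcases Nat.eq_zero_or_pos m with rfl | hpos
    · have e := sum_dualSeq_mul_top h hm (by simpa using h0)
      have e' := sum_dualSeq_mul_top h h0 h1
      have a0 := darbouxCoeff_last_ne_zero h h0 h1
      have a1 := darbouxCoeff_last_ne_zero h hm (by simpa using h0)
      have := casV_mul_darbouxCoeff_last (v := v) h0 h1
      simp only [Nat.cast_zero, add_zero, sub_add_cancel] at e e' this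
      rw [e, e']
      field_simp
      linear_combination -this
    · rw [sum_dualSeq_mul_eq_zero h hm (by omega) (by omega),
        sum_dualSeq_mul_eq_zero h h0 (by omega) (by omega)]
      ring
  rw [sum_dualSeq_mul_self h h0] at e3
  linear_combination e3 + e1 - casV v h n * e2 - φ n * eA

end Source

/-! ### Pairings with the operator applied to shifted generators -/

section Velocity

variable {m : ℕ} {h : Fin (m + 1) → ℤ → ℂ} {v p : ℤ → ℂ} {μ : Fin (m + 1) → ℂ} {n : ℤ}

/-- The spectral equation trades v^{(1)} h_j^{(1)} for -(p h_j + h_j^{(-1)}), because the μ_j h_j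
term is annihilated. The duals then leave boundary terms only. -/
theorem sum_dualSeq_mul_darbouxOp_shift
    (hL : ∀ j i, v (i + 1) * h j (i + 1) + p i * h j i + h j (i - 1) = μ j * h j i)
    (h0 : seqCas h n ≠ 0) (h1 : seqCas h (n + 1) ≠ 0) :
    ∑ j, dualSeq h n j * darbouxOp h (fun i => v (i + 1) * h j (i + 1)) n
      = p (n + m + 1) - casP p h n := by
  have e : ∀ j, darbouxOp h (fun i => v (i + 1) * h j (i + 1)) n
      = - darbouxOp h (fun i => p i * h j i + h j (i - 1)) n := fun j => by
    rw [show (fun i => v (i + 1) * h j (i + 1))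
      = fun i => μ j * h j i - (p i * h j i + h j (i - 1)) by
        funext i; linear_combination hL j i, darbouxOp_sub, darbouxOp_const_mul, darbouxOp_self]
    ring
  have e' : ∑ j, dualSeq h n j * darbouxOp h (fun i => v (i + 1) * h j (i + 1)) n
      = -(darbouxOp h (fun i => p i * ∑ j, dualSeq h n j * h j i) n
        + darbouxOp h (fun i => ∑ j, dualSeq h n j * h j (i - 1)) n) := by
    rw [← darbouxOp_add]
    have : (fun i => p i * (∑ j, dualSeq h n j * h j i) + ∑ j, dualSeq h n j * h j (i - 1))
        = fun i => ∑ j, dualSeq h n j * (p i * h j i + h j (i - 1)) := by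
      funext i
      rw [mul_sum, ← sum_add_distrib]
      exact sum_congr rfl fun j _ => by ring
    rw [this, darbouxOp_sum_const_mul, ← sum_neg_distrib]
    exact sum_congr rfl fun j _ => by rw [e j]; ring
  have a0 := darbouxCoeff_last_ne_zero h h0 h1
  rw [e', darbouxOp, sum_shift_eq_first_add_last _
    (fun i => p i * ∑ j, dualSeq h n j * h j i) n fun i hi hi' => by
      rw [sum_dualSeq_mul_eq_zero h h0 hi hi', mul_zero], darbouxOp, sum_shift_eq_two _
    (fun i => ∑ j, dualSeq h n j * h j (i - 1)) n fun i hi hi' =>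
      sum_dualSeq_mul_eq_zero h h0 (by omega) (by omega), add_sub_cancel_right,
    sum_dualSeq_mul_self h h0, sum_dualSeq_mul_top h h0 h1, sum_dualSeq_mul_pred h h0,
    darbouxCoeff_zero h n h1, casP]
  field_simp
  ring

theorem sum_dualSeq_succ_mul_darbouxOp_shift
    (h1 : seqCas h (n + 1) ≠ 0) (h2 : seqCas h (n + 2) ≠ 0) :
    ∑ j, dualSeq h (n + 1) j * darbouxOp h (fun i => v (i + 1) * h j (i + 1)) n
      = v (n + 1) - casV v h (n + 1) := by
  have e : ∑ j, dualSeq h (n + 1) j * darbouxOp h (fun i => v (i + 1) * h j (i + 1)) n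
      = darbouxOp h (fun i => v (i + 1) * ∑ j, dualSeq h (n + 1) j * h j (i + 1)) n := by
    rw [← darbouxOp_sum_const_mul]
    congr 1
    funext i
    rw [mul_sum]
    exact sum_congr rfl fun j _ => by ring
  have h2' : seqCas h (n + 1 + 1) ≠ 0 := by rwa [add_assoc]
  have a1 := darbouxCoeff_last_ne_zero h h1 h2'
  have hv := casV_mul_darbouxCoeff_last (v := v) h1 h2'
  have ht := sum_dualSeq_mul_top h h1 h2'
  rw [add_sub_cancel_right] at hv
  rw [show n + 1 + m + 1 = n + m + 1 + 1 by ring] at hv ht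
  rw [e, darbouxOp, sum_shift_eq_first_add_last _
    (fun i => v (i + 1) * ∑ j, dualSeq h (n + 1) j * h j (i + 1)) n fun i hi hi' => by
      rw [sum_dualSeq_mul_eq_zero h h1 (by omega) (by omega), mul_zero],
    sum_dualSeq_mul_self h h1, ht, darbouxCoeff_zero h n h1]
  field_simp
  linear_combination hv

theorem Interpolates.darbouxOp_shift_sub {ψ : ℤ → ℂ} {β : Fin (m + 1) → ℂ}
    (hβ : Interpolates h n ψ β) (h1 : seqCas h (n + 1) ≠ 0) (h2 : seqCas h (n + 2) ≠ 0) :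
    darbouxOp h (fun i => v (i + 1) * ψ (i + 1)) n
      - ∑ j, β j * darbouxOp h (fun i => v (i + 1) * h j (i + 1)) n
      = casV v h (n + 1) * darbouxOp h ψ (n + 1) := by
  rw [hβ.casV_mul_darbouxOp_succ h1 h2, ← darbouxOp_sum_const_mul, ← darbouxOp_sub]
  have : (fun i => v (i + 1) * ψ (i + 1) - ∑ j, β j * (v (i + 1) * h j (i + 1)))
      = fun i => v (i + 1) * (ψ (i + 1) - ∑ j, β j * h j (i + 1)) := by
    funext i
    rw [mul_sub, mul_sum]
    congr 1
    exact sum_congr rfl fun j _ => by ring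
  rw [this, darbouxOp, sum_shift_eq_last _
    (fun i => v (i + 1) * (ψ (i + 1) - ∑ j, β j * h j (i + 1))) n fun i hi hi' => by
      rw [hβ (i + 1) (by omega) (by omega), sub_self, mul_zero]]

end Velocity

/-- The Darboux-covariant potential `(κ - lam)⁻¹ W(φ, ψ)`, whose difference is `φ ψ`. -/
noncomputable def sourceSeq (v : ℤ → ℂ) (lam : ℂ) (φ : ℤ → ℂ) (κ : ℂ) (ψ : ℤ → ℂ) (i : ℤ) : ℂ :=
  (κ - lam)⁻¹ * adjCas v φ ψ i

theorem sub_mul_sourceSeq {v φ ψ : ℤ → ℂ} {lam κ : ℂ} (hne : κ ≠ lam) (i : ℤ) :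
    (κ - lam) * sourceSeq v lam φ κ ψ i = adjCas v φ ψ i :=
  mul_inv_cancel_left₀ (sub_ne_zero.2 hne) _

theorem sourceSeq_sub_pred {v p φ ψ : ℤ → ℂ} {lam κ : ℂ}
    (hφ : ∀ i, v i * φ (i - 1) + p i * φ i + φ (i + 1) = lam * φ i)
    (hψ : ∀ i, v (i + 1) * ψ (i + 1) + p i * ψ i + ψ (i - 1) = κ * ψ i) (hne : κ ≠ lam) (i : ℤ) :
    sourceSeq v lam φ κ ψ i - sourceSeq v lam φ κ ψ (i - 1) = φ i * ψ i := by
  rw [sourceSeq, sourceSeq, ← mul_sub, adjCas_sub_pred hφ hψ,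
    inv_mul_cancel_left₀ (sub_ne_zero.2 hne)]

theorem sum_Ico_sub_pred (D : ℤ → ℂ) (a b : ℤ) (hab : a ≤ b) :
    ∑ i ∈ Ico a b, (D (i + 1) - D i) = D b - D a := by
  induction b, hab using Int.leInduction with
  | base => simp
  | succ b hb ih =>
    have : Ico a (b + 1) = insert b (Ico a b) := by ext i; simp; omega
    rw [this, sum_insert (by simp), ih]
    ring

/-- The sum in the forward Darboux transformation of the adjoint sources telescopes. -/
theorem sourceSum_eq {v p φ ψ : LatticeFn} {lam κ : ℂ} {t : ℝ}
    (hφ : ∀ i, v i t * φ (i - 1) t + p i t * φ i t + φ (i + 1) t = lam * φ i t)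
    (hψ : ∀ i, v (i + 1) t * ψ (i + 1) t + p i t * ψ i t + ψ (i - 1) t = κ * ψ i t)
    (hne : κ ≠ lam) (n : ℤ) :
    sourceSum v lam φ κ ψ n t
      = sourceSeq (fun i => v i t) lam (fun i => φ i t) κ (fun i => ψ i t) n := by
  set D := sourceSeq (fun i => v i t) lam (fun i => φ i t) κ (fun i => ψ i t) with hD
  have hd : ∀ i, φ (i + 1) t * ψ (i + 1) t = D (i + 1) - D i := fun i => by
    have := sourceSeq_sub_pred (v := fun i => v i t) (p := fun i => p i t)
      (φ := fun i => φ i t) (ψ := fun i => ψ i t) hφ hψ hne (i + 1)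
    rw [add_sub_cancel_right] at this
    exact this.symm
  -- The boundary term in `sourceSum` is the value of the potential at site 0, which fixes the
  -- constant of summation.
  have h0 : (κ - lam)⁻¹ * (v 1 t * ψ 1 t * φ 0 t - ψ 0 t * φ 1 t) = D 0 := by
    simp [hD, sourceSeq, adjCas]
  rw [sourceSum, h0, invDelta]
  simp only [hd]
  split_ifs with hn
  · rw [sum_Ico_sub_pred D _ _ hn]
    ring
  · rw [sum_Ico_sub_pred D _ _ (by omega)]
    ring

/-! ### The Casorati formulas in terms of operator coefficients and duals -/

section Determinants

variable {l m : ℕ}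

theorem casCons_eq_seqCas (ψ : LatticeFn) (h : Fin l → LatticeFn) (n : ℤ) (t : ℝ) :
    casCons ψ h n t
      = seqCas (Fin.cons (α := fun _ => ℤ → ℂ) (fun i => ψ i t) fun j i => h j i t) n := by
  rw [casCons, cas, seqCas]
  congr 2
  ext i j
  refine Fin.cases ?_ (fun i => ?_) i <;> simp

theorem casCons_div_cas (ψ : LatticeFn) (h : Fin l → LatticeFn) (n : ℤ) (t : ℝ) :
    casCons ψ h n t / cas h (n + 1) t
      = darbouxOp (fun j i => h j i t) (fun i => ψ i t) n := by
  rw [darbouxOp_eq_det, casCons_eq_seqCas]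
  rfl

theorem darbouxCoeff_one (h : Fin (m + 1) → LatticeFn) (n : ℤ) (t : ℝ) :
    darbouxCoeff (fun j i => h j i t) n 1 = -(wcas h n t / cas h (n + 1) t) := by
  have : (Matrix.of fun i j : Fin (m + 1) =>
      h i (n + ((((1 : Fin (m + 2)).succAbove j : Fin (m + 2)) : ℕ) : ℤ)) t)
      = Matrix.of fun i j : Fin (m + 1) =>
        h i (n + (if (j : ℕ) = 0 then 0 else ((j : ℕ) : ℤ) + 1)) t := by
    ext i j
    refine Fin.cases ?_ (fun j => ?_) j
    · simp
    · have : (1 : Fin (m + 2)).succAbove j.succ = j.succ.succ :=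
        Fin.succAbove_of_le_castSucc _ _ (by simp [Fin.le_def])
      simp [this]
  rw [darbouxCoeff, this, wcas, ← neg_div]
  simp [cas, seqCas]

/-- Cramer's rule: deleting the column of shift 0 leaves a minor based at `n + 1`. -/
theorem dualSeq_eq (h : Fin (m + 1) → ℤ → ℂ) (n : ℤ) (j : Fin (m + 1)) :
    dualSeq h n j
      = (-1) ^ (j : ℕ) * seqCas (fun i => h (j.succAbove i)) (n + 1) / seqCas h n := by
  rw [dualSeq, Matrix.inv_def, Matrix.smul_apply, Matrix.adjugate_fin_succ_eq_det_submatrix,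
    Ring.inverse_eq_inv', smul_eq_mul, seqCas, seqCas, inv_mul_eq_div]
  congr 3
  ext i k
  simp only [Matrix.submatrix_apply, Matrix.of_apply, Fin.succAbove_zero, Fin.val_succ]
  congr 1
  push_cast
  ring

theorem casOmit_div_cas (h : Fin (m + 1) → LatticeFn) (j : Fin (m + 1)) (n : ℤ) (t : ℝ) :
    casOmit h j (n + 1) t / cas h n t
      = (-1) ^ (j : ℕ) * dualSeq (fun j i => h j i t) n j := by
  rw [dualSeq_eq, mul_div_assoc, ← mul_assoc, ← mul_pow]
  simp only [mul_neg, mul_one, neg_neg, one_pow, one_mul]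
  rfl

theorem bcas_div_cas (Sh h : Fin (m + 1) → LatticeFn) (n : ℤ) (t : ℝ) :
    bcas Sh h n t / cas h n t = ∑ j, dualSeq (fun j i => h j i t) n j * Sh j n t := by
  rw [bcas, Matrix.det_succ_row_zero, sum_div]
  refine sum_congr rfl fun j _ => ?_
  rw [dualSeq_eq]
  have : ((Matrix.of fun k j : Fin (m + 1) =>
      if (k : ℕ) = 0 then Sh j n t else h j (n + ((k : ℕ) : ℤ)) t).submatrix Fin.succ
        j.succAbove).det = seqCas (fun i i' => h (j.succAbove i) i' t) (n + 1) := by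
    rw [seqCas, ← Matrix.det_transpose]
    congr 1
    ext i k
    simp only [Matrix.transpose_apply, Matrix.submatrix_apply, Matrix.of_apply, Fin.val_succ,
      Nat.succ_ne_zero, if_false]
    congr 1
    push_cast
    ring
  rw [this]
  simp only [Matrix.of_apply, Fin.val_zero, if_true]
  have e : cas h n t = seqCas (fun j i => h j i t) n := rfl
  rw [e]
  ring

end Determinants

/-! ### Pairings with the time derivatives of the generators -/

section Velocity

variable {N m : ℕ} {v p : ℤ → ℂ} {plus minus : Fin N → ℤ → ℂ} {ev : Fin N → ℂ}
  {h f : Fin (m + 1) → ℤ → ℂ} {μ : Fin (m + 1) → ℂ} {n : ℤ}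

/-- The time derivative of an eigenfunction `ψ` at `κ`, up to the gauge `k`. -/
noncomputable def velocity (v : ℤ → ℂ) (plus minus : Fin N → ℤ → ℂ) (ev : Fin N → ℂ) (κ k : ℂ)
    (ψ : ℤ → ℂ) (i : ℤ) : ℂ :=
  -(v (i + 1) * ψ (i + 1)) + ∑ a, plus a i * sourceSeq v (ev a) (minus a) κ ψ i - k * ψ i

theorem darbouxOp_velocity {l : ℕ} (h : Fin l → ℤ → ℂ) (n : ℤ) (κ k : ℂ) (ψ : ℤ → ℂ) :
    darbouxOp h (velocity v plus minus ev κ k ψ) n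
      = -darbouxOp h (fun i => v (i + 1) * ψ (i + 1)) n
        + ∑ a, darbouxOp h (fun i => plus a i * sourceSeq v (ev a) (minus a) κ ψ i) n
        - k * darbouxOp h ψ n := by
  rw [← darbouxOp_const_mul, ← darbouxOp_sum, neg_eq_neg_one_mul, ← darbouxOp_const_mul,
    ← darbouxOp_add, ← darbouxOp_sub]
  congr 1
  funext i
  rw [velocity]
  ring

/-- The gauge term is a multiple of `h j`, so `k` drops out. -/
theorem darbouxOp_velocity_sub {l : ℕ} (h : Fin l → ℤ → ℂ) (n : ℤ) (κ k r : ℂ) (j : Fin l)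
    (f : ℤ → ℂ) :
    darbouxOp h (fun i => velocity v plus minus ev κ k (h j) i - r * f i) n
      = -darbouxOp h (fun i => v (i + 1) * h j (i + 1)) n
        + ∑ a, darbouxOp h (fun i => plus a i * sourceSeq v (ev a) (minus a) κ (h j) i) n
        - r * darbouxOp h f n := by
  rw [darbouxOp_sub, darbouxOp_velocity, darbouxOp_const_mul, darbouxOp_self]
  ring

variable (hL : ∀ j i, v (i + 1) * h j (i + 1) + p i * h j i + h j (i - 1) = μ j * h j i)
  (hminus : ∀ a i, v i * minus a (i - 1) + p i * minus a i + minus a (i + 1) = ev a * minus a i)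
  (hne : ∀ j a, μ j ≠ ev a)
include hL hminus hne

/-- Once the `r j` terms are read as added sources, the right side is the new p + Σ φ_+φ_- at `n`
minus the old one at `n + m + 1`. -/
theorem sum_dualSeq_mul_velocity (k r : Fin (m + 1) → ℂ)
    (h0 : seqCas h n ≠ 0) (h1 : seqCas h (n + 1) ≠ 0) :
    ∑ j, dualSeq h n j * darbouxOp h (fun i =>
        velocity v plus minus ev (μ j) (k j) (h j) i - r j * f j i) n
      = casP p h n + ∑ a, darbouxOp h (plus a) n
          * (∑ j, dualSeq h n j * sourceSeq v (ev a) (minus a) (μ j) (h j) n)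
        - ∑ j, r j * (dualSeq h n j * darbouxOp h (f j) n)
        - (p (n + m + 1) + ∑ a, plus a (n + m + 1) * minus a (n + m + 1)) := by
  have e : ∀ a, _ := fun a => sum_dualSeq_mul_darbouxOp_source
    (fun j i => sourceSeq_sub_pred (hminus a) (hL j) (hne j a) i) (plus a) h0 h1
  have e' : ∑ j, dualSeq h n j * darbouxOp h (fun i =>
        velocity v plus minus ev (μ j) (k j) (h j) i - r j * f j i) n
      = -(∑ j, dualSeq h n j * darbouxOp h (fun i => v (i + 1) * h j (i + 1)) n)
        + ∑ a, ∑ j, dualSeq h n j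
          * darbouxOp h (fun i => plus a i * sourceSeq v (ev a) (minus a) (μ j) (h j) i) n
        - ∑ j, r j * (dualSeq h n j * darbouxOp h (f j) n) := by
    rw [sum_comm, ← sum_neg_distrib, ← sum_add_distrib, ← sum_sub_distrib]
    refine sum_congr rfl fun j _ => ?_
    rw [darbouxOp_velocity_sub, ← mul_sum]
    ring
  rw [e', sum_dualSeq_mul_darbouxOp_shift hL h0 h1]
  simp only [e, sum_sub_distrib]
  ring

theorem sum_dualSeq_succ_mul_velocity (k r : Fin (m + 1) → ℂ)
    (h1 : seqCas h (n + 1) ≠ 0) (h2 : seqCas h (n + 2) ≠ 0) :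
    ∑ j, dualSeq h (n + 1) j * darbouxOp h (fun i =>
        velocity v plus minus ev (μ j) (k j) (h j) i - r j * f j i) n
      = casV v h (n + 1) - v (n + 1)
        + ∑ a, (darbouxOp h (plus a) n
            * (∑ j, dualSeq h (n + 1) j * sourceSeq v (ev a) (minus a) (μ j) (h j) (n + 1))
          - plus a n * minus a (n + 1))
        - ∑ j, r j * (dualSeq h (n + 1) j * darbouxOp h (f j) n) := by
  have e : ∀ a, _ := fun a => sum_dualSeq_succ_mul_darbouxOp_source
    (fun j i => sourceSeq_sub_pred (hminus a) (hL j) (hne j a) i) (plus a) h1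
  have e' : ∑ j, dualSeq h (n + 1) j * darbouxOp h (fun i =>
        velocity v plus minus ev (μ j) (k j) (h j) i - r j * f j i) n
      = -(∑ j, dualSeq h (n + 1) j * darbouxOp h (fun i => v (i + 1) * h j (i + 1)) n)
        + ∑ a, ∑ j, dualSeq h (n + 1) j
          * darbouxOp h (fun i => plus a i * sourceSeq v (ev a) (minus a) (μ j) (h j) i) n
        - ∑ j, r j * (dualSeq h (n + 1) j * darbouxOp h (f j) n) := by
    rw [sum_comm, ← sum_neg_distrib, ← sum_add_distrib, ← sum_sub_distrib]
    refine sum_congr rfl fun j _ => ?_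
    rw [darbouxOp_velocity_sub, ← mul_sum]
    ring
  rw [e', sum_dualSeq_succ_mul_darbouxOp_shift h1 h2]
  simp only [e]
  ring

theorem Interpolates.darbouxOp_velocity_sub {ψ : ℤ → ℂ} {κ : ℂ} {β : Fin (m + 1) → ℂ}
    (hβ : Interpolates h n ψ β)
    (hψ : ∀ i, v (i + 1) * ψ (i + 1) + p i * ψ i + ψ (i - 1) = κ * ψ i)
    (hκ : ∀ a, κ ≠ ev a) (c : ℂ) (k r : Fin (m + 1) → ℂ)
    (h1 : seqCas h (n + 1) ≠ 0) (h2 : seqCas h (n + 2) ≠ 0) :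
    darbouxOp h (velocity v plus minus ev κ c ψ) n
      - ∑ j, β j * darbouxOp h (fun i =>
        velocity v plus minus ev (μ j) (k j) (h j) i - r j * f j i) n
      = -(casV v h (n + 1) * darbouxOp h ψ (n + 1))
        + ∑ a, darbouxOp h (plus a) n * (sourceSeq v (ev a) (minus a) κ ψ n
          - ∑ j, β j * sourceSeq v (ev a) (minus a) (μ j) (h j) n)
        - c * darbouxOp h ψ n + ∑ j, r j * (β j * darbouxOp h (f j) n) := by
  have e : ∀ a, _ := fun a => hβ.darbouxOp_source_sub
    (S := fun j => sourceSeq v (ev a) (minus a) (μ j) (h j))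
    (fun j i => sourceSeq_sub_pred (hminus a) (hL j) (hne j a) i)
    (fun i => sourceSeq_sub_pred (hminus a) hψ (hκ a) i) (plus a)
  have e' : ∑ j, β j * darbouxOp h (fun i =>
        velocity v plus minus ev (μ j) (k j) (h j) i - r j * f j i) n
      = -(∑ j, β j * darbouxOp h (fun i => v (i + 1) * h j (i + 1)) n)
        + ∑ a, ∑ j, β j
          * darbouxOp h (fun i => plus a i * sourceSeq v (ev a) (minus a) (μ j) (h j) i) n
        - ∑ j, r j * (β j * darbouxOp h (f j) n) := by
    rw [sum_comm, ← sum_neg_distrib, ← sum_add_distrib, ← sum_sub_distrib]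
    refine sum_congr rfl fun j _ => ?_
    rw [_root_.darbouxOp_velocity_sub, ← mul_sum]
    ring
  rw [e', darbouxOp_velocity, ← hβ.darbouxOp_shift_sub h1 h2]
  simp only [← e, sum_sub_distrib]
  ring

end Velocity

theorem differentiableAt_det {l : ℕ} {A : ℝ → Matrix (Fin l) (Fin l) ℂ} {t : ℝ}
    (hA : ∀ i j, DifferentiableAt ℝ (fun s => A s i j) t) :
    DifferentiableAt ℝ (fun s => (A s).det) t := by
  simp only [Matrix.det_apply]
  refine DifferentiableAt.fun_sum fun σ _ => ?_
  exact (DifferentiableAt.fun_finsetProd fun i _ => hA _ _).const_smul _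

/-! ### Time derivatives of the operator and of its coefficients -/

section Time

variable {l m : ℕ} {n : ℤ} {t : ℝ}

theorem differentiableAt_seqCas {h : Fin l → LatticeFn}
    (hh : ∀ j i, DifferentiableAt ℝ (h j i) t) (n : ℤ) :
    DifferentiableAt ℝ (fun s => seqCas (fun j i => h j i s) n) t :=
  differentiableAt_det fun i _ => hh i _

theorem differentiableAt_darbouxCoeff {h : Fin l → LatticeFn}
    (hh : ∀ j i, DifferentiableAt ℝ (h j i) t) (hn : seqCas (fun j i => h j i t) (n + 1) ≠ 0)
    (k : Fin (l + 1)) :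
    DifferentiableAt ℝ (fun s => darbouxCoeff (fun j i => h j i s) n k) t := by
  refine DifferentiableAt.fun_div ?_ (differentiableAt_seqCas hh _) hn
  exact (differentiableAt_det fun i _ => hh i _).const_mul _

theorem differentiableAt_dualSeq {h : Fin (m + 1) → LatticeFn}
    (hh : ∀ j i, DifferentiableAt ℝ (h j i) t) (hn : seqCas (fun j i => h j i t) n ≠ 0)
    (j : Fin (m + 1)) :
    DifferentiableAt ℝ (fun s => dualSeq (fun j i => h j i s) n j) t := by
  simp only [dualSeq_eq]
  refine DifferentiableAt.fun_div ?_ (differentiableAt_seqCas hh _) hn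
  exact (differentiableAt_seqCas (h := fun i => h (j.succAbove i)) (fun i => hh _) _).const_mul _

variable {h : Fin l → LatticeFn} {hd : Fin l → ℤ → ℂ}
  (hh : ∀ j i, HasDerivAt (h j i) (hd j i) t)
include hh

theorem eventually_seqCas_ne_zero (hn : seqCas (fun j i => h j i t) n ≠ 0) :
    ∀ᶠ s in nhds t, seqCas (fun j i => h j i s) n ≠ 0 :=
  (differentiableAt_seqCas (fun j i => (hh j i).differentiableAt) n).continuousAt.eventually_ne hn

theorem hasDerivAt_darbouxOp {ψ : LatticeFn} {ψd : ℤ → ℂ}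
    (hn : seqCas (fun j i => h j i t) (n + 1) ≠ 0) (hψ : ∀ i, HasDerivAt (ψ i) (ψd i) t) :
    HasDerivAt (fun s => darbouxOp (fun j i => h j i s) (fun i => ψ i s) n)
      ((∑ k, deriv (fun s => darbouxCoeff (fun j i => h j i s) n k) t
        * ψ (n + ((k : ℕ) : ℤ)) t) + darbouxOp (fun j i => h j i t) ψd n) t := by
  rw [darbouxOp, ← sum_add_distrib]
  exact HasDerivAt.fun_sum fun k _ => (differentiableAt_darbouxCoeff
    (fun j i => (hh j i).differentiableAt) hn k).hasDerivAt.mul (hψ _)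

theorem deriv_darbouxCoeff_zero (hn : seqCas (fun j i => h j i t) (n + 1) ≠ 0) :
    deriv (fun s => darbouxCoeff (fun j i => h j i s) n 0) t = 0 := by
  have : (fun s => darbouxCoeff (fun j i => h j i s) n 0) =ᶠ[nhds t] fun _ => 1 :=
    (eventually_seqCas_ne_zero hh hn).mono fun s hs => darbouxCoeff_zero _ _ hs
  rw [this.deriv_eq, deriv_const]

/-- Differentiate the identity T h_j = 0 in time and combine the results with the constants β_j. -/
theorem sum_deriv_darbouxCoeff_mul (hn : seqCas (fun j i => h j i t) (n + 1) ≠ 0)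
    (β : Fin l → ℂ) :
    ∑ k, deriv (fun s => darbouxCoeff (fun j i => h j i s) n k) t
        * ∑ j, β j * h j (n + ((k : ℕ) : ℤ)) t
      = -∑ j, β j * darbouxOp (fun j i => h j i t) (hd j) n := by
  have e : ∀ j, ∑ k, deriv (fun s => darbouxCoeff (fun j i => h j i s) n k) t
      * h j (n + ((k : ℕ) : ℤ)) t = -darbouxOp (fun j i => h j i t) (hd j) n := fun j => by
    have h1 := hasDerivAt_darbouxOp hh hn (hh j)
    have h2 : (fun s => darbouxOp (fun j i => h j i s) (fun i => h j i s) n) = fun _ => 0 :=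
      funext fun s => darbouxOp_self (fun j i => h j i s) n j
    rw [h2] at h1
    linear_combination h1.unique (hasDerivAt_const t (0 : ℂ))
  simp only [mul_sum]
  rw [sum_comm, ← sum_neg_distrib]
  refine sum_congr rfl fun j _ => ?_
  rw [← mul_neg, ← e j, mul_sum]
  exact sum_congr rfl fun k _ => by ring

end Time

section Evolution

variable {m : ℕ} {n : ℤ} {t : ℝ} {h : Fin (m + 1) → LatticeFn} {hd : Fin (m + 1) → ℤ → ℂ}
  (hh : ∀ j i, HasDerivAt (h j i) (hd j i) t)
include hh

/-- `β` is frozen at time `t`. The zeroth coefficient is constant, so the derivatives of the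
coefficients meet `ψ` only at interpolated sites, where it may be replaced by Σ β_j h_j. -/
theorem Interpolates.hasDerivAt_darbouxOp {ψ : LatticeFn} {ψd : ℤ → ℂ} {β : Fin (m + 1) → ℂ}
    (hβ : Interpolates (fun j i => h j i t) n (fun i => ψ i t) β)
    (hn : seqCas (fun j i => h j i t) (n + 1) ≠ 0) (hψ : ∀ i, HasDerivAt (ψ i) (ψd i) t) :
    HasDerivAt (fun s => darbouxOp (fun j i => h j i s) (fun i => ψ i s) n)
      (darbouxOp (fun j i => h j i t) ψd n
        - ∑ j, β j * darbouxOp (fun j i => h j i t) (hd j) n) t := by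
  refine (_root_.hasDerivAt_darbouxOp hh hn hψ).congr_deriv ?_
  rw [sub_eq_neg_add, ← sum_deriv_darbouxCoeff_mul hh hn β]
  congr 1
  refine sum_congr rfl fun k _ => ?_
  refine Fin.cases ?_ (fun k => ?_) k
  · rw [deriv_darbouxCoeff_zero hh hn, zero_mul, zero_mul]
  · rw [hβ _ (by simp) (by simp; omega)]

/-- Taking for `β` the duals based at `n + 1` isolates the first shift; those based at `n` isolate
the last one. -/
theorem hasDerivAt_darbouxCoeff_one (hn : seqCas (fun j i => h j i t) (n + 1) ≠ 0) :
    HasDerivAt (fun s => darbouxCoeff (fun j i => h j i s) n 1)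
      (-∑ j, dualSeq (fun j i => h j i t) (n + 1) j
        * darbouxOp (fun j i => h j i t) (hd j) n) t := by
  refine (differentiableAt_darbouxCoeff (fun j i => (hh j i).differentiableAt) hn
    1).hasDerivAt.congr_deriv ?_
  rw [← sum_deriv_darbouxCoeff_mul hh hn, sum_shift_eq_two _
    (fun i => ∑ j, dualSeq (fun j i => h j i t) (n + 1) j * h j i t) n
    fun i hi hi' => sum_dualSeq_mul_eq_zero (fun j i => h j i t) hn hi (by omega),
    deriv_darbouxCoeff_zero hh hn, sum_dualSeq_mul_self (fun j i => h j i t) hn]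
  ring

theorem hasDerivAt_darbouxCoeff_last (h0 : seqCas (fun j i => h j i t) n ≠ 0)
    (hn : seqCas (fun j i => h j i t) (n + 1) ≠ 0) :
    HasDerivAt (fun s => darbouxCoeff (fun j i => h j i s) n (Fin.last (m + 1)))
      (darbouxCoeff (fun j i => h j i t) n (Fin.last (m + 1))
        * ∑ j, dualSeq (fun j i => h j i t) n j
          * darbouxOp (fun j i => h j i t) (hd j) n) t := by
  refine (differentiableAt_darbouxCoeff (fun j i => (hh j i).differentiableAt) hn
    (Fin.last (m + 1))).hasDerivAt.congr_deriv ?_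
  have e := sum_deriv_darbouxCoeff_mul hh hn (dualSeq (fun j i => h j i t) n)
  rw [sum_shift_eq_first_add_last _
    (fun i => ∑ j, dualSeq (fun j i => h j i t) n j * h j i t) n
    fun i hi hi' => sum_dualSeq_mul_eq_zero (fun j i => h j i t) h0 hi hi',
    deriv_darbouxCoeff_zero hh hn, sum_dualSeq_mul_top (fun j i => h j i t) h0 hn] at e
  have a0 := darbouxCoeff_last_ne_zero (fun j i => h j i t) h0 hn
  rw [← neg_eq_iff_eq_neg] at e
  rw [← e]
  field_simp
  ring

end Evolution

/-- A continuous logarithm of a differentiable nonvanishing function is differentiable. -/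
theorem IsLogBranchAt.hasDerivAt {y w : ℝ → ℂ} {t : ℝ} {w' : ℂ} (hy : IsLogBranchAt y w t)
    (hw : HasDerivAt w w' t) : HasDerivAt y (w' / w t) t := by
  obtain ⟨hc, hyt⟩ := hy.self_of_nhds
  have hw0 : w t ≠ 0 := hyt ▸ Complex.exp_ne_zero _
  have hq : HasDerivAt (fun s => w s / w t) (w' / w t) t := hw.div_const _
  have hlog : HasDerivAt (fun s => y t + Complex.log (w s / w t)) (w' / w t) t := by
    have := hq.clog_real (by simp [div_self hw0, Complex.one_mem_slitPlane])
    rw [div_self hw0, div_one] at this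
    exact this.const_add _
  refine hlog.congr_of_eventuallyEq ?_
  -- This bound keeps the imaginary part of `y s - y t` in the range where `Complex.log` inverts
  -- `exp`.
  have hball : ∀ᶠ s in nhds t, ‖y s - y t‖ < Real.pi := by
    have : Filter.Tendsto (fun s => ‖y s - y t‖) (nhds t) (nhds ‖y t - y t‖) :=
      (hc.sub continuousAt_const).norm
    exact this.eventually_lt_const (by simpa using Real.pi_pos)
  filter_upwards [hy, hball] with s hs hb
  have him := abs_lt.1 ((Complex.abs_im_le_norm (y s - y t)).trans_lt hb)
  rw [← hs.2, ← hyt, ← Complex.exp_sub, Complex.log_exp him.1 him.2.le]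
  ring

/-- Each summand gains and loses a₀ b₁ ψ₀. With b₁ = φ_{j-}^{(1)} the two brackets become the
bilinear forms of φ_{j-} with ψ and with φ_{j+}. -/
theorem evolution_eq_gauged {ι : Type*} [Fintype ι] (v₁ ψ₀ ψ₁ lam : ℂ) (ev a₀ a₁ b₀ b₁ : ι → ℂ) :
    -(v₁ * ψ₁ + ∑ j, 1 / (lam - ev j) * (v₁ * b₀ j * (a₁ j * ψ₀ - a₀ j * ψ₁)))
      = -(v₁ * ψ₁) + ∑ j, a₀ j * ((lam - ev j)⁻¹ * (v₁ * ψ₁ * b₀ j - ψ₀ * b₁ j))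
        - (∑ j, (lam - ev j)⁻¹ * (v₁ * a₁ j * b₀ j - a₀ j * b₁ j)) * ψ₀ := by
  rw [sum_mul, neg_add, ← sum_neg_distrib, add_sub_assoc, ← sum_sub_distrib]
  congr 1
  refine sum_congr rfl fun j _ => ?_
  rw [one_div]
  ring

/-! ### The Casorati fields: spectral equations of all sources -/

namespace TodaState

variable {N m : ℕ} {S : TodaState N}

section Background

theorem IsSolution.plus_spectral (hS : S.IsSolution) (a : Fin N) (t : ℝ) (i : ℤ) :
    S.v (i + 1) t * S.plus a (i + 1) t + S.p i t * S.plus a i t + S.plus a (i - 1) t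
      = S.ev a * S.plus a i t :=
  (hS i t).1.plus_eq a

theorem IsSolution.minus_spectral (hS : S.IsSolution) (a : Fin N) (t : ℝ) (i : ℤ) :
    S.v i t * S.minus a (i - 1) t + S.p i t * S.minus a i t + S.minus a (i + 1) t
      = S.ev a * S.minus a i t :=
  (hS i t).1.minus_eq a

/-- A source and its adjoint share one eigenvalue, so the Green identity has zero right side. This
makes `gauge` independent of the site. -/
theorem IsSolution.adjCas_const (hS : S.IsSolution) (a : Fin N) (t : ℝ) (i : ℤ) :
    adjCas (fun i => S.v i t) (fun i => S.minus a i t) (fun i => S.plus a i t) i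
      = adjCas (fun i => S.v i t) (fun i => S.minus a i t) (fun i => S.plus a i t) 0 := by
  have e : ∀ i, adjCas (fun i => S.v i t) (fun i => S.minus a i t) (fun i => S.plus a i t) i
      = adjCas (fun i => S.v i t) (fun i => S.minus a i t) (fun i => S.plus a i t) (i - 1) :=
    fun i => by
      have := adjCas_sub_pred (v := fun i => S.v i t) (p := fun i => S.p i t)
        (φ := fun i => S.minus a i t) (ψ := fun i => S.plus a i t) (hS.minus_spectral a t) (hS.plus_spectral a t) i
      rw [sub_self, zero_mul, sub_eq_zero] at this
      exact this
  rcases le_total 0 i with hi | hi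
  · exact eq_of_forall_eq_pred (b := i) (fun k _ _ => e k) i hi le_rfl
  · exact (eq_of_forall_eq_pred (a := i) (b := 0) (fun k _ _ => e k) 0 hi le_rfl).symm

/-- The scalar by which the evolution of an eigenfunction at `κ` differs from `velocity … 0`. -/
noncomputable def gauge (S : TodaState N) (κ : ℂ) (t : ℝ) : ℂ :=
  ∑ a, (κ - S.ev a)⁻¹
    * adjCas (fun i => S.v i t) (fun i => S.minus a i t) (fun i => S.plus a i t) 0

theorem IsSolution.hasDerivAt_eigenfunction (hS : S.IsSolution) {κ : ℂ} {ψ : LatticeFn} {n : ℤ}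
    {t : ℝ} (hψ : S.IsEigenfunctionAt κ ψ n t) :
    HasDerivAt (ψ n) (velocity (fun i => S.v i t) (fun a i => S.plus a i t)
      (fun a i => S.minus a i t) S.ev κ (S.gauge κ t) (fun i => ψ i t) n) t := by
  refine hψ.evolution.congr_deriv ?_
  rw [evolution_eq_gauged (b₁ := fun j => S.minus j (n + 1) t), velocity, gauge]
  congr 2
  exact sum_congr rfl fun a _ => by rw [← hS.adjCas_const a t n]; rfl

end Background

/-- The data of a repeated Darboux transformation of a solution. -/
structure IsDressing (S : TodaState N) (D : Fin (m + 1) → DarbouxSeed) : Prop where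
  sol : S.IsSolution
  f_eigen : ∀ j n t, S.IsEigenfunctionAt (D j).mu (D j).f n t
  g_eigen : ∀ j n t, S.IsEigenfunctionAt (D j).mu (D j).g n t
  mu_ne_ev : ∀ j a, (D j).mu ≠ S.ev a
  α_diff : ∀ j, Differentiable ℝ (D j).α
  α_ne_zero : ∀ j t, (D j).α t ≠ 0
  cd_eq : ∀ j t, (D j).c t * (D j).d t
    = (-1) ^ ((j : ℕ) + 1) * (deriv (D j).α t / (D j).α t)

/-- The generating functions of a repeated Darboux transformation at a fixed time. -/
def generators {l : ℕ} (D : Fin l → DarbouxSeed) (t : ℝ) : Fin l → ℤ → ℂ :=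
  fun j i => (D j).h i t

/-- The time derivatives of the generating functions. -/
noncomputable def generatorVelocity (S : TodaState N) (D : Fin (m + 1) → DarbouxSeed) (t : ℝ)
    (j : Fin (m + 1)) (i : ℤ) : ℂ :=
  velocity (fun i => S.v i t) (fun a i => S.plus a i t) (fun a i => S.minus a i t) S.ev (D j).mu
      (S.gauge (D j).mu t - deriv (D j).α t / (D j).α t) (generators D t j) i
    - deriv (D j).α t / (D j).α t * (D j).f i t

section Dressing

variable {D : Fin (m + 1) → DarbouxSeed} {y : LatticeFn} {n : ℤ} {t : ℝ}

theorem IsDressing.generators_spectral (H : S.IsDressing D) (t : ℝ) (j : Fin (m + 1)) (i : ℤ) :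
    S.v (i + 1) t * generators D t j (i + 1) + S.p i t * generators D t j i
      + generators D t j (i - 1) = (D j).mu * generators D t j i := by
  have hf : S.v (i + 1) t * (D j).f (i + 1) t + S.p i t * (D j).f i t + (D j).f (i - 1) t
    = (D j).mu * (D j).f i t := (H.f_eigen j i t).spectral
  have hg : S.v (i + 1) t * (D j).g (i + 1) t + S.p i t * (D j).g i t + (D j).g (i - 1) t
    = (D j).mu * (D j).g i t := (H.g_eigen j i t).spectral
  simp only [generators, DarbouxSeed.h]
  linear_combination hf + (D j).α t * hg

theorem velocity_add_const_mul (v : ℤ → ℂ) (plus minus : Fin N → ℤ → ℂ) (ev : Fin N → ℂ)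
    (κ k c : ℂ) (ψ χ : ℤ → ℂ) (i : ℤ) :
    velocity v plus minus ev κ k (fun i => ψ i + c * χ i) i
      = velocity v plus minus ev κ k ψ i + c * velocity v plus minus ev κ k χ i := by
  have : ∑ a, plus a i * sourceSeq v (ev a) (minus a) κ (fun i => ψ i + c * χ i) i
      = ∑ a, plus a i * sourceSeq v (ev a) (minus a) κ ψ i
        + c * ∑ a, plus a i * sourceSeq v (ev a) (minus a) κ χ i := by
    rw [mul_sum, ← sum_add_distrib]
    exact sum_congr rfl fun a _ => by simp only [sourceSeq, adjCas]; ring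
  simp only [velocity, this]
  ring

/-- The term α̇ g of the product rule equals (α̇/α)(h - f): its `h` part only shifts the gauge, and
-(α̇/α) f is the seed of the added source. -/
theorem IsDressing.hasDerivAt_generators (H : S.IsDressing D) (t : ℝ) (j : Fin (m + 1)) (i : ℤ) :
    HasDerivAt ((D j).h i) (S.generatorVelocity D t j i) t := by
  have hf := H.sol.hasDerivAt_eigenfunction (H.f_eigen j i t)
  have hg := H.sol.hasDerivAt_eigenfunction (H.g_eigen j i t)
  have hα := (H.α_diff j t).hasDerivAt
  refine (hf.add (hα.mul hg)).congr_deriv ?_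
  have e : generators D t j = fun i => (D j).f i t + (D j).α t * (D j).g i t := rfl
  have e' : generators D t j i = (D j).f i t + (D j).α t * (D j).g i t := rfl
  have hk : ∀ (κ k r : ℂ) (ψ : ℤ → ℂ), velocity (fun i => S.v i t) (fun a i => S.plus a i t)
      (fun a i => S.minus a i t) S.ev κ (k - r) ψ i = velocity (fun i => S.v i t)
      (fun a i => S.plus a i t) (fun a i => S.minus a i t) S.ev κ k ψ i + r * ψ i :=
    fun κ k r ψ => by simp only [velocity]; ring
  rw [generatorVelocity, hk, e', e, velocity_add_const_mul]
  have h0 := H.α_ne_zero j t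
  field_simp
  ring

section Fields

variable (S D y n t)

theorem casoratiFDT_v :
    (S.casoratiFDT D y).v n t = casV (fun i => S.v i t) (generators D t) n := rfl

theorem casoratiFDT_p :
    (S.casoratiFDT D y).p n t = casP (fun i => S.p i t) (generators D t) n := by
  have e := darbouxCoeff_one (fun j => (D j).h) n t
  have e' := darbouxCoeff_one (fun j => (D j).h) (n - 1) t
  rw [sub_add_cancel] at e'
  change _ = S.p n t + darbouxCoeff (fun j i => (D j).h i t) n 1
    - darbouxCoeff (fun j i => (D j).h i t) (n - 1) 1
  rw [e, e', casoratiFDT]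
  ring

theorem casoratiFDT_plus_castAdd (a : Fin N) :
    (S.casoratiFDT D y).plus (Fin.castAdd (m + 1) a) n t
      = darbouxOp (generators D t) (fun i => S.plus a i t) n := by
  simp only [casoratiFDT, Fin.append_left]
  exact casCons_div_cas _ _ _ _

theorem casoratiFDT_plus_natAdd (j : Fin (m + 1)) :
    (S.casoratiFDT D y).plus (Fin.natAdd N j) n t
      = (D j).c t * darbouxOp (generators D t) (fun i => (D j).f i t) n := by
  simp only [casoratiFDT, Fin.append_right]
  rw [casCons_div_cas]
  rfl

theorem casoratiFDT_minus_natAdd (j : Fin (m + 1)) :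
    (S.casoratiFDT D y).minus (Fin.natAdd N j) n t
      = (D j).d t * ((-1) ^ (j : ℕ) * dualSeq (generators D t) n j) := by
  simp only [casoratiFDT, Fin.append_right]
  rw [casOmit_div_cas]
  rfl

end Fields

/-- The potential of the `a`-th source and the `j`-th generating function. -/
noncomputable def potential (S : TodaState N) (D : Fin (m + 1) → DarbouxSeed) (t : ℝ)
    (a : Fin N) (j : Fin (m + 1)) (i : ℤ) : ℂ :=
  sourceSeq (fun i => S.v i t) (S.ev a) (fun i => S.minus a i t) (D j).mu (generators D t j) i

theorem IsDressing.casoratiFDT_minus_castAdd (H : S.IsDressing D) (y : LatticeFn) (a : Fin N)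
    (n : ℤ) (t : ℝ) :
    (S.casoratiFDT D y).minus (Fin.castAdd (m + 1) a) n t
      = ∑ j, dualSeq (generators D t) n j * S.potential D t a j n := by
  simp only [casoratiFDT, Fin.append_left]
  rw [bcas_div_cas]
  refine sum_congr rfl fun j _ => ?_
  rw [sourceSum_eq (p := S.p) (H.sol.minus_spectral a t) (H.generators_spectral t j)
    (H.mu_ne_ev j a)]
  rfl

theorem IsDressing.potential_sub_pred (H : S.IsDressing D) (t : ℝ) (a : Fin N) (j : Fin (m + 1))
    (i : ℤ) :
    S.potential D t a j i - S.potential D t a j (i - 1) = S.minus a i t * generators D t j i :=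
  sourceSeq_sub_pred (p := fun i => S.p i t) (H.sol.minus_spectral a t)
    (H.generators_spectral t j) (H.mu_ne_ev j a) i

theorem IsDressing.sub_mul_potential (H : S.IsDressing D) (t : ℝ) (a : Fin N) (j : Fin (m + 1))
    (i : ℤ) :
    ((D j).mu - S.ev a) * S.potential D t a j i
      = adjCas (fun i => S.v i t) (fun i => S.minus a i t) (generators D t j) i :=
  sub_mul_sourceSeq (H.mu_ne_ev j a) i

theorem IsDressing.plus_spectral (H : S.IsDressing D) (h0 : seqCas (generators D t) n ≠ 0)
    (h1 : seqCas (generators D t) (n + 1) ≠ 0) (h2 : seqCas (generators D t) (n + 2) ≠ 0)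
    (k : Fin (N + (m + 1))) :
    todaL (S.casoratiFDT D y).v (S.casoratiFDT D y).p ((S.casoratiFDT D y).plus k) n t
      = (S.casoratiFDT D y).ev k * (S.casoratiFDT D y).plus k n t := by
  refine Fin.addCases (fun a => ?_) (fun j => ?_) k
  · have := darbouxOp_spectral (v := fun i => S.v i t) (p := fun i => S.p i t)
      (ψ := fun i => S.plus a i t) (H.generators_spectral t) (H.sol.plus_spectral a t) h0 h1 h2
    simp only [todaL, casoratiFDT_v, casoratiFDT_p, casoratiFDT_plus_castAdd]
    rw [this]
    simp [casoratiFDT]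
  · have := darbouxOp_spectral (v := fun i => S.v i t) (p := fun i => S.p i t)
      (ψ := fun i => (D j).f i t) (H.generators_spectral t) (fun i => (H.f_eigen j i t).spectral) h0 h1 h2
    simp only [todaL, casoratiFDT_v, casoratiFDT_p, casoratiFDT_plus_natAdd]
    rw [show (S.casoratiFDT D y).ev (Fin.natAdd N j) = (D j).mu by simp [casoratiFDT]]
    linear_combination (D j).c t * this

theorem IsDressing.minus_spectral (H : S.IsDressing D) (hm : seqCas (generators D t) (n - 1) ≠ 0)
    (h0 : seqCas (generators D t) n ≠ 0) (h1 : seqCas (generators D t) (n + 1) ≠ 0)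
    (k : Fin (N + (m + 1))) :
    todaLAdj (S.casoratiFDT D y).v (S.casoratiFDT D y).p ((S.casoratiFDT D y).minus k) n t
      = (S.casoratiFDT D y).ev k * (S.casoratiFDT D y).minus k n t := by
  refine Fin.addCases (fun a => ?_) (fun j => ?_) k
  · have := dualSource_spectral (v := fun i => S.v i t) (p := fun i => S.p i t)
      (H.potential_sub_pred t a) (H.generators_spectral t) (H.sub_mul_potential t a) hm h0 h1
    simp only [todaLAdj, casoratiFDT_v, casoratiFDT_p, H.casoratiFDT_minus_castAdd]
    rw [this]
    simp [casoratiFDT]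
  · have := dualSeq_spectral (v := fun i => S.v i t) (p := fun i => S.p i t)
      (H.generators_spectral t) hm h0 h1 j
    simp only [todaLAdj, casoratiFDT_v, casoratiFDT_p, casoratiFDT_minus_natAdd]
    rw [show (S.casoratiFDT D y).ev (Fin.natAdd N j) = (D j).mu by simp [casoratiFDT]]
    linear_combination (D j).d t * (-1) ^ (j : ℕ) * this

/-- The Casorati form of an old source and its adjoint is preserved. -/
theorem IsDressing.adjCas_castAdd (H : S.IsDressing D) (h0 : seqCas (generators D t) n ≠ 0)
    (h1 : seqCas (generators D t) (n + 1) ≠ 0) (h2 : seqCas (generators D t) (n + 2) ≠ 0)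
    (a : Fin N) :
    (S.casoratiFDT D y).v (n + 1) t * (S.casoratiFDT D y).plus (Fin.castAdd (m + 1) a) (n + 1) t
        * (S.casoratiFDT D y).minus (Fin.castAdd (m + 1) a) n t
      - (S.casoratiFDT D y).plus (Fin.castAdd (m + 1) a) n t
        * (S.casoratiFDT D y).minus (Fin.castAdd (m + 1) a) (n + 1) t
      = adjCas (fun i => S.v i t) (fun i => S.minus a i t) (fun i => S.plus a i t) n := by
  obtain ⟨β, hβ⟩ := exists_interpolates (n := n) (fun i => S.plus a i t) h1
  have := hβ.casV_mul_sub (v := fun i => S.v i t) (p := fun i => S.p i t)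
    (H.potential_sub_pred t a) (H.generators_spectral t) (H.sub_mul_potential t a)
    (H.sol.plus_spectral a t) h0 h1 h2
  rw [sub_self, zero_mul, sub_zero] at this
  simp only [casoratiFDT_v, H.casoratiFDT_minus_castAdd, casoratiFDT_plus_castAdd]
  exact this

/-- The Casorati form of an added source and its adjoint vanishes. -/
theorem IsDressing.adjCas_natAdd (H : S.IsDressing D) (h0 : seqCas (generators D t) n ≠ 0)
    (h1 : seqCas (generators D t) (n + 1) ≠ 0) (h2 : seqCas (generators D t) (n + 2) ≠ 0)
    (j : Fin (m + 1)) :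
    (S.casoratiFDT D y).v (n + 1) t * (S.casoratiFDT D y).plus (Fin.natAdd N j) (n + 1) t
        * (S.casoratiFDT D y).minus (Fin.natAdd N j) n t
      - (S.casoratiFDT D y).plus (Fin.natAdd N j) n t
        * (S.casoratiFDT D y).minus (Fin.natAdd N j) (n + 1) t = 0 := by
  obtain ⟨β, hβ⟩ := exists_interpolates (n := n) (fun i => (D j).f i t) h1
  have := hβ.sub_eigenvalue_mul (v := fun i => S.v i t) (p := fun i => S.p i t)
    (H.generators_spectral t) (fun i => (H.f_eigen j i t).spectral) h0 h1 h2 j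
  rw [sub_self, zero_mul] at this
  simp only [casoratiFDT_v, casoratiFDT_minus_natAdd, casoratiFDT_plus_natAdd]
  linear_combination (D j).c t * (D j).d t * (-1) ^ (j : ℕ) * this

/-- The sign in c_j d_j and the cofactor sign of the dual combine to -1 for every `j`. -/
theorem IsDressing.plus_mul_minus_natAdd (H : S.IsDressing D) (j : Fin (m + 1)) (n n' : ℤ)
    (t : ℝ) :
    (S.casoratiFDT D y).plus (Fin.natAdd N j) n t
        * (S.casoratiFDT D y).minus (Fin.natAdd N j) n' t
      = -(deriv (D j).α t / (D j).α t * (dualSeq (generators D t) n' j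
        * darbouxOp (generators D t) (fun i => (D j).f i t) n)) := by
  have hs : ((-1 : ℂ) ^ (j : ℕ)) * (-1) ^ (j : ℕ) = 1 := by
    rw [← mul_pow]; simp
  rw [casoratiFDT_minus_natAdd, casoratiFDT_plus_natAdd]
  linear_combination (-1) ^ (j : ℕ) * dualSeq (generators D t) n' j
    * darbouxOp (generators D t) (fun i => (D j).f i t) n * H.cd_eq j t
    - (deriv (D j).α t / (D j).α t * (dualSeq (generators D t) n' j
        * darbouxOp (generators D t) (fun i => (D j).f i t) n)) * hs

end Dressing

end TodaState

/-! ### Time evolution of the Casorati fields -/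

namespace TodaState

variable {N m : ℕ} {S : TodaState N} {D : Fin (m + 1) → DarbouxSeed} {y : LatticeFn} {n : ℤ}
  {t : ℝ}

/-- `p + ∑ φ_+ φ_-`, the time derivative of `x`. -/
noncomputable def momentum {M : ℕ} (C : TodaState M) (n : ℤ) (t : ℝ) : ℂ :=
  C.p n t + ∑ j, C.plus j n t * C.minus j n t

theorem IsDressing.momentum_casoratiFDT (H : S.IsDressing D) (y : LatticeFn) (n : ℤ) (t : ℝ) :
    (S.casoratiFDT D y).momentum n t
      = casP (fun i => S.p i t) (generators D t) n
        + ∑ a, darbouxOp (generators D t) (fun i => S.plus a i t) n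
          * (∑ j, dualSeq (generators D t) n j * S.potential D t a j n)
        - ∑ j, deriv (D j).α t / (D j).α t * (dualSeq (generators D t) n j
          * darbouxOp (generators D t) (fun i => (D j).f i t) n) := by
  rw [momentum, Fin.sum_univ_add, casoratiFDT_p]
  simp only [H.plus_mul_minus_natAdd, casoratiFDT_plus_castAdd, H.casoratiFDT_minus_castAdd,
    sum_neg_distrib]
  ring

theorem IsDressing.hasDerivAt_darbouxCoeff_last (H : S.IsDressing D) (y : LatticeFn)
    (h0 : seqCas (generators D t) n ≠ 0) (h1 : seqCas (generators D t) (n + 1) ≠ 0) :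
    HasDerivAt (fun s => darbouxCoeff (generators D s) n (Fin.last (m + 1)))
      (darbouxCoeff (generators D t) n (Fin.last (m + 1))
        * ((S.casoratiFDT D y).momentum n t - S.momentum (n + m + 1) t)) t := by
  refine (_root_.hasDerivAt_darbouxCoeff_last (h := fun j => (D j).h)
    (H.hasDerivAt_generators t) h0 h1).congr_deriv ?_
  congr 1
  refine (sum_dualSeq_mul_velocity (f := fun j i => (D j).f i t)
    (H.generators_spectral t) (fun a => H.sol.minus_spectral a t) H.mu_ne_ev
    (fun j => S.gauge (D j).mu t - deriv (D j).α t / (D j).α t)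
    (fun j => deriv (D j).α t / (D j).α t) h0 h1).trans ?_
  rw [H.momentum_casoratiFDT]
  rfl

/-- The pairing produces products φ_+(n) φ_-(n+1); the bilinear form, preserved for old sources and
zero for added ones, trades them for v φ_+(n+1) φ_-(n). In p[l] the old terms at `n` and `n - 1`
then cancel against p_t. -/
theorem IsDressing.hasDerivAt_darbouxCoeff_one (H : S.IsDressing D) (y : LatticeFn)
    (h0 : seqCas (generators D t) n ≠ 0) (h1 : seqCas (generators D t) (n + 1) ≠ 0)
    (h2 : seqCas (generators D t) (n + 2) ≠ 0) :
    HasDerivAt (fun s => darbouxCoeff (generators D s) n 1)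
      (S.v (n + 1) t * (1 + ∑ a, S.minus a n t * S.plus a (n + 1) t)
        - (S.casoratiFDT D y).v (n + 1) t * (1 + ∑ k, (S.casoratiFDT D y).minus k n t
          * (S.casoratiFDT D y).plus k (n + 1) t)) t := by
  refine (_root_.hasDerivAt_darbouxCoeff_one (h := fun j => (D j).h)
    (H.hasDerivAt_generators t) h1).congr_deriv ?_
  rw [neg_eq_iff_eq_neg]
  refine (sum_dualSeq_succ_mul_velocity (f := fun j i => (D j).f i t)
    (H.generators_spectral t) (fun a => H.sol.minus_spectral a t) H.mu_ne_ev
    (fun j => S.gauge (D j).mu t - deriv (D j).α t / (D j).α t)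
    (fun j => deriv (D j).α t / (D j).α t) h1 h2).trans ?_
  set C := S.casoratiFDT D y with hC
  have e1 : ∑ a : Fin N, (darbouxOp (generators D t) (fun i => S.plus a i t) n
      * (∑ j, dualSeq (generators D t) (n + 1) j * sourceSeq (fun i => S.v i t) (S.ev a)
        (fun i => S.minus a i t) (D j).mu (generators D t j) (n + 1))
      - S.plus a n t * S.minus a (n + 1) t)
      = C.v (n + 1) t * (∑ a : Fin N, C.minus (Fin.castAdd (m + 1) a) n t
          * C.plus (Fin.castAdd (m + 1) a) (n + 1) t)
        - S.v (n + 1) t * ∑ a, S.minus a n t * S.plus a (n + 1) t := by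
    rw [mul_sum, mul_sum, ← sum_sub_distrib]
    refine sum_congr rfl fun a _ => ?_
    have := H.adjCas_castAdd (y := y) h0 h1 h2 a
    rw [H.casoratiFDT_minus_castAdd y a (n + 1), casoratiFDT_plus_castAdd S D y n, adjCas] at this
    simp only [potential] at this
    linear_combination -this
  have e2 : C.v (n + 1) t * (∑ j : Fin (m + 1), C.minus (Fin.natAdd N j) n t
          * C.plus (Fin.natAdd N j) (n + 1) t)
      = -∑ j, deriv (D j).α t / (D j).α t * (dualSeq (generators D t) (n + 1) j
        * darbouxOp (generators D t) (fun i => (D j).f i t) n) := by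
    rw [mul_sum, ← sum_neg_distrib]
    refine sum_congr rfl fun j _ => ?_
    have := H.adjCas_natAdd (y := y) h0 h1 h2 j
    rw [H.plus_mul_minus_natAdd j n (n + 1)] at this
    linear_combination this
  have e3 : C.v (n + 1) t = casV (fun i => S.v i t) (generators D t) (n + 1) := rfl
  rw [Fin.sum_univ_add (fun k => C.minus k n t * C.plus k (n + 1) t), e1, ← e3]
  linear_combination -e2

/-- Logarithmic differentiation of v(n+m+1) a(n-1)/a(n), a the last coefficient: the old momenta
cancel. -/
theorem IsDressing.hasDerivAt_v (H : S.IsDressing D) (y : LatticeFn)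
    (hm : seqCas (generators D t) (n - 1) ≠ 0)
    (h0 : seqCas (generators D t) n ≠ 0) (h1 : seqCas (generators D t) (n + 1) ≠ 0) :
    HasDerivAt ((S.casoratiFDT D y).v n)
      ((S.casoratiFDT D y).v n t * ((S.casoratiFDT D y).momentum (n - 1) t
        - (S.casoratiFDT D y).momentum n t)) t := by
  have hh := H.hasDerivAt_generators t
  have h0' : seqCas (generators D t) (n - 1 + 1) ≠ 0 := by rwa [sub_add_cancel]
  have da := H.hasDerivAt_darbouxCoeff_last y h0 h1
  have db := H.hasDerivAt_darbouxCoeff_last y hm h0'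
  have a0 := darbouxCoeff_last_ne_zero (generators D t) h0 h1
  have dv : HasDerivAt (S.v (n + m + 1)) (S.v (n + m + 1) t
      * (S.momentum (n + m) t - S.momentum (n + m + 1) t)) t := by
    refine (H.sol (n + m + 1) t).1.v_eq.congr_deriv ?_
    simp only [momentum, add_sub_cancel_right, mul_comm (S.minus _ _ _)]
    ring
  have ev : (S.casoratiFDT D y).v n =ᶠ[nhds t] fun s => S.v (n + m + 1) s
      * darbouxCoeff (generators D s) (n - 1) (Fin.last (m + 1))
      / darbouxCoeff (generators D s) n (Fin.last (m + 1)) := by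
    filter_upwards [eventually_seqCas_ne_zero (h := fun j => (D j).h) hh h0,
      eventually_seqCas_ne_zero (h := fun j => (D j).h) hh h1] with s s0 s1
    rw [eq_div_iff (darbouxCoeff_last_ne_zero (generators D s) s0 s1)]
    have := casV_mul_darbouxCoeff_last (v := fun i => S.v i s) (h := generators D s) s0 s1
    rw [casoratiFDT_v, this]
  refine (((dv.fun_mul db).fun_div da a0).congr_of_eventuallyEq ev).congr_deriv ?_
  rw [ev.self_of_nhds, show n - 1 + m + 1 = n + m by ring]
  beta_reduce
  generalize darbouxCoeff (generators D t) n (Fin.last (m + 1)) = A at a0 ⊢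
  field_simp
  ring

theorem IsDressing.hasDerivAt_p (H : S.IsDressing D) (y : LatticeFn)
    (hm : seqCas (generators D t) (n - 1) ≠ 0) (h0 : seqCas (generators D t) n ≠ 0)
    (h1 : seqCas (generators D t) (n + 1) ≠ 0) (h2 : seqCas (generators D t) (n + 2) ≠ 0) :
    HasDerivAt ((S.casoratiFDT D y).p n)
      ((S.casoratiFDT D y).v n t * (1 + ∑ k, (S.casoratiFDT D y).minus k (n - 1) t
          * (S.casoratiFDT D y).plus k n t)
        - (S.casoratiFDT D y).v (n + 1) t * (1 + ∑ k, (S.casoratiFDT D y).minus k n t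
          * (S.casoratiFDT D y).plus k (n + 1) t)) t := by
  have da := H.hasDerivAt_darbouxCoeff_one y h0 h1 h2
  have db := H.hasDerivAt_darbouxCoeff_one y hm (by rwa [sub_add_cancel])
    (by rwa [show n - 1 + 2 = n + 1 by ring])
  have dp := (H.sol n t).1.p_eq
  have e : (S.casoratiFDT D y).p n = fun s => S.p n s + darbouxCoeff (generators D s) n 1
      - darbouxCoeff (generators D s) (n - 1) 1 := funext fun s => casoratiFDT_p S D y n s
  rw [e]
  refine ((dp.add da).sub db).congr_deriv ?_
  rw [sub_add_cancel]
  ring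

theorem IsDressing.differentiableAt_darbouxOp (H : S.IsDressing D) {ψ : LatticeFn}
    (hψ : ∀ i, DifferentiableAt ℝ (ψ i) t) (h1 : seqCas (generators D t) (n + 1) ≠ 0) :
    DifferentiableAt ℝ (fun s => darbouxOp (generators D s) (fun i => ψ i s) n) t :=
  (hasDerivAt_darbouxOp (h := fun j => (D j).h) (H.hasDerivAt_generators t) h1
    fun i => (hψ i).hasDerivAt).differentiableAt

theorem IsDressing.differentiableAt_plus (H : S.IsDressing D)
    (hc : ∀ j, Differentiable ℝ (D j).c) (y : LatticeFn)
    (h1 : seqCas (generators D t) (n + 1) ≠ 0) (k : Fin (N + (m + 1))) :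
    DifferentiableAt ℝ ((S.casoratiFDT D y).plus k n) t := by
  refine Fin.addCases (fun a => ?_) (fun j => ?_) k
  · rw [funext (casoratiFDT_plus_castAdd S D y n · a)]
    exact H.differentiableAt_darbouxOp (fun i => (H.sol i t).1.plus_diff a) h1
  · rw [funext (casoratiFDT_plus_natAdd S D y n · j)]
    exact (hc j t).mul (H.differentiableAt_darbouxOp
      (fun i => (H.f_eigen j i t).evolution.differentiableAt) h1)

theorem IsDressing.differentiableAt_minus (H : S.IsDressing D)
    (hd : ∀ j, Differentiable ℝ (D j).d) (y : LatticeFn)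
    (h0 : seqCas (generators D t) n ≠ 0) (k : Fin (N + (m + 1))) :
    DifferentiableAt ℝ ((S.casoratiFDT D y).minus k n) t := by
  have hh : ∀ j i, DifferentiableAt ℝ ((D j).h i) t :=
    fun j i => (H.hasDerivAt_generators t j i).differentiableAt
  have hu : ∀ j, DifferentiableAt ℝ (fun s => dualSeq (generators D s) n j) t :=
    fun j => differentiableAt_dualSeq hh h0 j
  refine Fin.addCases (fun a => ?_) (fun j => ?_) k
  · rw [funext (H.casoratiFDT_minus_castAdd y a n)]
    refine DifferentiableAt.fun_sum fun j _ => (hu j).mul ?_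
    refine DifferentiableAt.const_mul ?_ _
    exact ((((H.sol (n + 1) t).1.v_eq.differentiableAt).mul (hh j _)).mul
      ((H.sol n t).1.minus_diff a)).sub ((hh j _).mul ((H.sol (n + 1) t).1.minus_diff a))
  · rw [funext (casoratiFDT_minus_natAdd S D y n · j)]
    exact (hd j t).mul ((hu j).const_mul _)

theorem IsDressing.solvesTLSCSAt (H : S.IsDressing D) (hc : ∀ j, Differentiable ℝ (D j).c)
    (hd : ∀ j, Differentiable ℝ (D j).d) (y : LatticeFn)
    (hm : seqCas (generators D t) (n - 1) ≠ 0) (h0 : seqCas (generators D t) n ≠ 0)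
    (h1 : seqCas (generators D t) (n + 1) ≠ 0) (h2 : seqCas (generators D t) (n + 2) ≠ 0) :
    (S.casoratiFDT D y).SolvesTLSCSAt n t where
  v_eq := by
    refine (H.hasDerivAt_v y hm h0 h1).congr_deriv ?_
    simp only [momentum, mul_comm ((S.casoratiFDT D y).minus _ _ _)]
    ring
  p_eq := H.hasDerivAt_p y hm h0 h1 h2
  plus_eq := H.plus_spectral h0 h1 h2
  minus_eq := H.minus_spectral hm h0 h1
  plus_diff := H.differentiableAt_plus hc y h1
  minus_diff := H.differentiableAt_minus hd y h0

theorem IsDressing.isEigenfunctionAt (H : S.IsDressing D) {lam : ℂ} {ψ : LatticeFn}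
    (hlam_ev : ∀ a, lam ≠ S.ev a) (hlam_mu : ∀ j, lam ≠ (D j).mu)
    (hψ : ∀ n t, S.IsEigenfunctionAt lam ψ n t) (y : LatticeFn)
    (h0 : seqCas (generators D t) n ≠ 0)
    (h1 : seqCas (generators D t) (n + 1) ≠ 0) (h2 : seqCas (generators D t) (n + 2) ≠ 0) :
    (S.casoratiFDT D y).IsEigenfunctionAt lam (casEigen (fun j => (D j).h) ψ) n t := by
  have e : ∀ n t, casEigen (fun j => (D j).h) ψ n t
      = darbouxOp (generators D t) (fun i => ψ i t) n := fun n t => casCons_div_cas _ _ _ _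
  have hsp : ∀ i, S.v (i + 1) t * ψ (i + 1) t + S.p i t * ψ i t + ψ (i - 1) t = lam * ψ i t :=
    fun i => (hψ i t).spectral
  refine ⟨?_, ?_⟩
  · have := darbouxOp_spectral (v := fun i => S.v i t) (p := fun i => S.p i t)
      (ψ := fun i => ψ i t) (H.generators_spectral t) hsp h0 h1 h2
    simp only [todaL, casoratiFDT_v, casoratiFDT_p, e]
    exact this
  · rw [funext (e n)]
    obtain ⟨β, hβ⟩ := exists_interpolates (n := n) (fun i => ψ i t) h1
    refine (hβ.hasDerivAt_darbouxOp (h := fun j => (D j).h) (H.hasDerivAt_generators t) h1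
      fun i => H.sol.hasDerivAt_eigenfunction (hψ i t)).congr_deriv ?_
    refine (hβ.darbouxOp_velocity_sub (f := fun j i => (D j).f i t)
      (H.generators_spectral t) (fun a => H.sol.minus_spectral a t) H.mu_ne_ev
      hsp hlam_ev (S.gauge lam t) (fun j => S.gauge (D j).mu t - deriv (D j).α t / (D j).α t)
      (fun j => deriv (D j).α t / (D j).α t) h1 h2).trans ?_
    rw [evolution_eq_gauged (b₁ := fun k => (S.casoratiFDT D y).minus k (n + 1) t), e]
    beta_reduce
    set C := S.casoratiFDT D y with hC
    -- The gauge is unchanged: old sources keep their bilinear form and added ones contribute zero.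
    have eg : ∑ k, (lam - C.ev k)⁻¹ * (C.v (n + 1) t * C.plus k (n + 1) t * C.minus k n t
        - C.plus k n t * C.minus k (n + 1) t) = S.gauge lam t := by
      rw [Fin.sum_univ_add]
      simp only [hC, H.adjCas_natAdd h0 h1 h2, H.adjCas_castAdd h0 h1 h2, H.sol.adjCas_const _ t n]
      simp [casoratiFDT, gauge]
    rw [eg, Fin.sum_univ_add fun k => C.plus k n t * ((lam - C.ev k)⁻¹ * (C.v (n + 1) t
      * darbouxOp (generators D t) (fun i => ψ i t) (n + 1) * C.minus k n t
      - darbouxOp (generators D t) (fun i => ψ i t) n * C.minus k (n + 1) t))]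
    have e1 : ∀ a : Fin N, (lam - C.ev (Fin.castAdd (m + 1) a))⁻¹ * (C.v (n + 1) t
        * darbouxOp (generators D t) (fun i => ψ i t) (n + 1) * C.minus (Fin.castAdd (m + 1) a) n t
        - darbouxOp (generators D t) (fun i => ψ i t) n
          * C.minus (Fin.castAdd (m + 1) a) (n + 1) t)
        = sourceSeq (fun i => S.v i t) (S.ev a) (fun i => S.minus a i t) lam (fun i => ψ i t) n
          - ∑ j, β j * S.potential D t a j n := fun a => by
      have := hβ.casV_mul_sub (v := fun i => S.v i t) (p := fun i => S.p i t)
        (H.potential_sub_pred t a) (H.generators_spectral t) (H.sub_mul_potential t a)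
        hsp h0 h1 h2
      rw [hC, H.casoratiFDT_minus_castAdd, H.casoratiFDT_minus_castAdd, casoratiFDT_v,
        show (S.casoratiFDT D y).ev (Fin.castAdd (m + 1) a) = S.ev a by simp [casoratiFDT], this,
        sourceSeq, mul_sub, inv_mul_cancel_left₀ (sub_ne_zero.2 (hlam_ev a))]
    -- The formula for (lam - μ_j)β_j cancels the denominator, and c_j d_j supplies α̇_j/α_j.
    have e2 : ∀ j : Fin (m + 1), C.plus (Fin.natAdd N j) n t
        * ((lam - C.ev (Fin.natAdd N j))⁻¹ * (C.v (n + 1) t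
        * darbouxOp (generators D t) (fun i => ψ i t) (n + 1) * C.minus (Fin.natAdd N j) n t
        - darbouxOp (generators D t) (fun i => ψ i t) n * C.minus (Fin.natAdd N j) (n + 1) t))
        = deriv (D j).α t / (D j).α t
          * (β j * darbouxOp (generators D t) (fun i => (D j).f i t) n) := fun j => by
      have := hβ.sub_eigenvalue_mul (v := fun i => S.v i t) (p := fun i => S.p i t)
        (H.generators_spectral t) hsp h0 h1 h2 j
      have hs : ((-1 : ℂ) ^ (j : ℕ)) * (-1) ^ (j : ℕ) = 1 := by
        rw [← mul_pow]; simp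
      have hne := sub_ne_zero.2 (hlam_mu j)
      rw [hC, casoratiFDT_minus_natAdd, casoratiFDT_minus_natAdd, casoratiFDT_v,
        casoratiFDT_plus_natAdd,
        show (S.casoratiFDT D y).ev (Fin.natAdd N j) = (D j).mu by simp [casoratiFDT]]
      have e3 : casV (fun i => S.v i t) (generators D t) (n + 1)
          * darbouxOp (generators D t) (fun i => ψ i t) (n + 1)
            * ((D j).d t * ((-1) ^ (j : ℕ) * dualSeq (generators D t) n j))
          - darbouxOp (generators D t) (fun i => ψ i t) n
            * ((D j).d t * ((-1) ^ (j : ℕ) * dualSeq (generators D t) (n + 1) j))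
          = (lam - (D j).mu) * (-((D j).d t * (-1) ^ (j : ℕ) * β j)) := by
        linear_combination (D j).d t * (-1) ^ (j : ℕ) * this
      rw [e3, inv_mul_cancel_left₀ hne]
      linear_combination -(-1) ^ (j : ℕ) * β j
        * darbouxOp (generators D t) (fun i => (D j).f i t) n * H.cd_eq j t
        + deriv (D j).α t / (D j).α t
          * (β j * darbouxOp (generators D t) (fun i => (D j).f i t) n) * hs
    simp only [e1, e2]
    simp only [hC, casoratiFDT_plus_castAdd, casoratiFDT_v]
    simp only [potential]
    ring

end TodaState

/-! ### The field `x` and its second-order equation -/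

namespace TodaState

variable {N m : ℕ} {S : TodaState N} {D : Fin (m + 1) → DarbouxSeed} {y : LatticeFn} {n : ℤ}
  {t : ℝ}

theorem casRatioSq_eq (D : Fin (m + 1) → DarbouxSeed) (n : ℤ) (t : ℝ) :
    casRatioSq (fun j => (D j).h) n t
      = darbouxCoeff (generators D t) n (Fin.last (m + 1)) ^ 2 := by
  rw [darbouxCoeff_last, mul_div_assoc, mul_pow, ← pow_mul, mul_comm (m + 1) 2, pow_mul,
    neg_one_sq, one_pow, one_mul]
  rfl

theorem IsDressing.momentumAt (H : S.IsDressing D) (h0 : seqCas (generators D t) n ≠ 0)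
    (h1 : seqCas (generators D t) (n + 1) ≠ 0)
    (hy : IsLogBranchAt (y n) (casRatioSq (fun j => (D j).h) n) t) :
    (S.casoratiFDT D y).MomentumAt n t := by
  have da := H.hasDerivAt_darbouxCoeff_last y h0 h1
  have a0 := darbouxCoeff_last_ne_zero (generators D t) h0 h1
  rw [funext (casRatioSq_eq D n)] at hy
  have dy := hy.hasDerivAt (da.fun_pow 2)
  have dx : HasDerivAt (S.x (n + ((m + 1 : ℕ) : ℤ))) (S.momentum (n + m + 1) t) t := by
    have := (H.sol (n + m + 1) t).2.2.1
    rw [MomentumAt] at this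
    push_cast
    rw [← add_assoc]
    exact this
  refine (dx.add (dy.const_mul (1 / 2))).congr_deriv ?_
  change _ = (S.casoratiFDT D y).momentum n t
  generalize darbouxCoeff (generators D t) n (Fin.last (m + 1)) = A at a0 ⊢
  field_simp
  ring

theorem IsDressing.exp_eq_or (H : S.IsDressing D)
    (h0 : seqCas (generators D t) n ≠ 0)
    (hy : IsLogBranchAt (y n) (casRatioSq (fun j => (D j).h) n) t)
    (hy' : IsLogBranchAt (y (n - 1)) (casRatioSq (fun j => (D j).h) (n - 1)) t) :
    Complex.exp ((S.casoratiFDT D y).x (n - 1) t - (S.casoratiFDT D y).x n t)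
        = (S.casoratiFDT D y).v n t ∨
      Complex.exp ((S.casoratiFDT D y).x (n - 1) t - (S.casoratiFDT D y).x n t)
        = -(S.casoratiFDT D y).v n t := by
  -- Half of a logarithm of a square enters `x`, so only the square of the exponential is
  -- determined.
  rw [← sq_eq_sq_iff_eq_or_eq_neg, ← Complex.exp_nat_mul]
  have e1 := hy.self_of_nhds.2
  have e2 := hy'.self_of_nhds.2
  have ev : S.v (n + ((m + 1 : ℕ) : ℤ)) t = Complex.exp (S.x (n - 1 + ((m + 1 : ℕ) : ℤ)) t
      - S.x (n + ((m + 1 : ℕ) : ℤ)) t) := by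
    have := (H.sol (n + ((m + 1 : ℕ) : ℤ)) t).2.1
    rw [ExpAt] at this
    rwa [show n - 1 + ((m + 1 : ℕ) : ℤ) = n + ((m + 1 : ℕ) : ℤ) - 1 by ring]
  have e3 : ((2 : ℕ) : ℂ) * ((S.casoratiFDT D y).x (n - 1) t - (S.casoratiFDT D y).x n t)
      = ((2 : ℕ) : ℂ) * (S.x (n - 1 + ((m + 1 : ℕ) : ℤ)) t - S.x (n + ((m + 1 : ℕ) : ℤ)) t)
        + y (n - 1) t - y n t := by
    simp only [casoratiFDT]
    push_cast
    ring
  rw [e3, Complex.exp_sub, Complex.exp_add, Complex.exp_nat_mul, ← ev, e1, e2, casoratiFDT_v,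
    casV, casRatioSq, casRatioSq, sub_add_cancel]
  change S.v (n + ((m + 1 : ℕ) : ℤ)) t ^ 2 * (seqCas (generators D t) (n - 1)
    / seqCas (generators D t) n) ^ 2 / (seqCas (generators D t) n
    / seqCas (generators D t) (n + 1)) ^ 2 = _
  field_simp

theorem IsDressing.solvesODEAt (H : S.IsDressing D) (hc : ∀ j, Differentiable ℝ (D j).c)
    (hd : ∀ j, Differentiable ℝ (D j).d)
    (hm : seqCas (generators D t) (n - 1) ≠ 0) (h0 : seqCas (generators D t) n ≠ 0)
    (h1 : seqCas (generators D t) (n + 1) ≠ 0) (h2 : seqCas (generators D t) (n + 2) ≠ 0)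
    (hy : IsLogBranchAt (y n) (casRatioSq (fun j => (D j).h) n) t)
    (hv : (S.casoratiFDT D y).ExpAt n t) (hv' : (S.casoratiFDT D y).ExpAt (n + 1) t) :
    (S.casoratiFDT D y).SolvesODEAt n t := by
  have hh := H.hasDerivAt_generators t
  -- The formula for x_t is about to be differentiated, so it is needed on a neighbourhood of `t`.
  have hx : ∀ᶠ s in nhds t, (S.casoratiFDT D y).MomentumAt n s := by
    filter_upwards [eventually_seqCas_ne_zero (h := fun j => (D j).h) hh h0,
      eventually_seqCas_ne_zero (h := fun j => (D j).h) hh h1,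
      eventually_eventually_nhds.2 hy] with s s0 s1 sy
    exact H.momentumAt s0 s1 sy
  have hs : ∀ k, DifferentiableAt ℝ (fun s => (S.casoratiFDT D y).plus k n s
      * (S.casoratiFDT D y).minus k n s) t :=
    fun k => (H.differentiableAt_plus hc y h1 k).mul (H.differentiableAt_minus hd y h0 k)
  refine ⟨hx.mono fun s hs => hs.differentiableAt, hs, ?_⟩
  have hderiv : deriv ((S.casoratiFDT D y).x n) =ᶠ[nhds t] fun s => (S.casoratiFDT D y).p n s
      + ∑ k, (S.casoratiFDT D y).plus k n s * (S.casoratiFDT D y).minus k n s :=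
    hx.mono fun s hs => hs.deriv
  refine (((H.hasDerivAt_p y hm h0 h1 h2).fun_add (HasDerivAt.fun_sum fun k (_ : k ∈ univ) =>
    (hs k).hasDerivAt)).congr_of_eventuallyEq hderiv).congr_deriv ?_
  rw [ExpAt] at hv hv'
  rw [add_sub_cancel_right] at hv'
  rw [← hv, ← hv']
  simp only [mul_comm ((S.casoratiFDT D y).minus _ _ _)]

end TodaState

/-! ### Factorisation of the operator into single steps -/

section Composition

variable {l m : ℕ} {n : ℤ}

/-- The sequences without the last one. -/
abbrev seqInit (h : Fin (l + 1) → ℤ → ℂ) : Fin l → ℤ → ℂ := fun j => h j.castSucc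

theorem darbouxOp_init_last (h : Fin (l + 1) → ℤ → ℂ) (n : ℤ) :
    darbouxOp (seqInit h) (h (Fin.last l)) n
      = (-1) ^ l * seqCas h n / seqCas (seqInit h) (n + 1) := by
  have hs : ((-1 : ℂ) ^ l) * (-1) ^ l = 1 := by
    rw [← mul_pow]; simp
  rw [seqCas, Matrix.det_succ_row _ (Fin.last l), mul_sum, sum_div, darbouxOp]
  refine sum_congr rfl fun k _ => ?_
  have : (Matrix.of fun i j : Fin (l + 1) => h i (n + ((j : ℕ) : ℤ))).submatrix
      (Fin.last l).succAbove k.succAbove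
      = Matrix.of fun i j : Fin l =>
        seqInit h i (n + (((k.succAbove j : Fin (l + 1)) : ℕ) : ℤ)) := by
    ext i j
    simp
  rw [this, darbouxCoeff]
  simp only [Matrix.of_apply, Fin.val_last, pow_add]
  linear_combination -((-1) ^ (k : ℕ) * h (Fin.last l) (n + ((k : ℕ) : ℤ))
    * (Matrix.of fun i j : Fin l =>
        seqInit h i (n + (((k.succAbove j : Fin (l + 1)) : ℕ) : ℤ))).det
    / seqCas (seqInit h) (n + 1)) * hs

theorem darbouxOp_init_last_ne_zero {h : Fin (l + 1) → ℤ → ℂ} (hn : seqCas h n ≠ 0)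
    (hn' : seqCas (seqInit h) (n + 1) ≠ 0) :
    darbouxOp (seqInit h) (h (Fin.last l)) n ≠ 0 := by
  rw [darbouxOp_init_last]
  exact div_ne_zero (mul_ne_zero (by simp) hn) hn'

/-- A repeated Darboux operator is the composition of one step with the previous ones. -/
theorem darbouxOp_succ {h : Fin (l + 1) → ℤ → ℂ} (h1 : seqCas h (n + 1) ≠ 0)
    (h1' : seqCas (seqInit h) (n + 1) ≠ 0) (h2' : seqCas (seqInit h) (n + 1 + 1) ≠ 0)
    (ψ : ℤ → ℂ) :
    darbouxOp h ψ n = darbouxOp (seqInit h) ψ n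
      - darbouxOp (seqInit h) (h (Fin.last l)) n / darbouxOp (seqInit h) (h (Fin.last l)) (n + 1)
        * darbouxOp (seqInit h) ψ (n + 1) := by
  obtain ⟨β, hβ⟩ := exists_interpolation h n ψ h1
  have hne := darbouxOp_init_last_ne_zero h1 h2'
  set r := darbouxOp (seqInit h) (h (Fin.last l)) n
    / darbouxOp (seqInit h) (h (Fin.last l)) (n + 1) with hr
  have hG : ∀ i, n < i → i ≤ n + (l + 1) → ψ i - ∑ j, β j * h j i = 0 := fun i hi hi' => by
    rw [hβ i hi (by push_cast; omega), sub_self]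
  -- Interpolate by all `l + 1` generators and apply the operator of the first `l`: of the
  -- combination only the last generator remains. At `n` this operator sees just the site `n` of the
  -- remainder (`e2`), at `n + 1` nothing (`e3`).
  have e1 : ∀ i, darbouxOp (seqInit h) (fun i => ψ i - ∑ j, β j * h j i) i
      = darbouxOp (seqInit h) ψ i
        - β (Fin.last l) * darbouxOp (seqInit h) (h (Fin.last l)) i := fun i => by
    rw [darbouxOp_sub, darbouxOp_sum_const_mul, Fin.sum_univ_castSucc, sum_eq_zero, zero_add]
    intro j _
    rw [darbouxOp_self (seqInit h) i j, mul_zero]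
  have e2 : darbouxOp (seqInit h) (fun i => ψ i - ∑ j, β j * h j i) n
      = ψ n - ∑ j, β j * h j n := by
    rw [darbouxOp, Fin.sum_univ_succ, darbouxCoeff_zero _ _ h1']
    refine (congrArg (_ + ·) (sum_eq_zero fun k _ => ?_)).trans (by simp)
    rw [hG _ (by simp) (by simp), mul_zero]
  have e3 : darbouxOp (seqInit h) (fun i => ψ i - ∑ j, β j * h j i) (n + 1) = 0 :=
    sum_eq_zero fun k _ => by
      beta_reduce
      rw [hG _ (by omega) (by omega), mul_zero]
  rw [e1] at e2 e3
  rw [darbouxOp_eq_of_interpolation h n h1 hβ, ← e2]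
  have e4 : r * darbouxOp (seqInit h) (h (Fin.last l)) (n + 1)
    = darbouxOp (seqInit h) (h (Fin.last l)) n := div_mul_cancel₀ _ hne
  linear_combination r * e3 + β (Fin.last l) * e4

theorem darbouxOp_single_succ {h : Fin (m + 1) → ℤ → ℂ} :
    darbouxOp h (Pi.single (n + 1) 1) n = darbouxCoeff h n 1 := by
  rw [darbouxOp, sum_shift_eq_two _ (Pi.single (n + 1) 1) n fun i hi _ =>
    Pi.single_eq_of_ne (by omega) _]
  rw [Pi.single_eq_same, Pi.single_eq_of_ne (by omega)]
  ring

/-- The operator at `n`, applied to the unit sequence at `n + 1`, reads off the coefficient of the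
first shift; the composition law is applied to that sequence. -/
theorem darbouxCoeff_one_succ {h : Fin (m + 1 + 1) → ℤ → ℂ} (h1 : seqCas h (n + 1) ≠ 0)
    (h1' : seqCas (seqInit h) (n + 1) ≠ 0) (h2' : seqCas (seqInit h) (n + 1 + 1) ≠ 0) :
    darbouxCoeff h n 1 = darbouxCoeff (seqInit h) n 1
      - darbouxOp (seqInit h) (h (Fin.last (m + 1))) n
        / darbouxOp (seqInit h) (h (Fin.last (m + 1))) (n + 1) := by
  have e : darbouxOp (seqInit h) (Pi.single (n + 1) 1) (n + 1) = 1 := by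
    rw [darbouxOp, sum_shift_eq_first_add_last _ (Pi.single (n + 1) 1) (n + 1) fun i hi _ =>
      Pi.single_eq_of_ne (by omega) _]
    rw [Pi.single_eq_same, Pi.single_eq_of_ne (by omega), darbouxCoeff_zero _ _ h2']
    ring
  rw [← darbouxOp_single_succ, ← darbouxOp_single_succ, darbouxOp_succ h1 h1' h2', e, mul_one]

/-- The last generator minus its interpolation by the others vanishes at n+1, …, n+m+1 and equals
the transformed generator at `n`; after normalisation it has the defining values of the dual
combination. -/
theorem dualSeq_succ {h : Fin (m + 1 + 1) → ℤ → ℂ} {β : Fin (m + 1) → ℂ}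
    (hβ : Interpolates (seqInit h) n (h (Fin.last (m + 1))) β)
    (h0 : seqCas h n ≠ 0) (h1' : seqCas (seqInit h) (n + 1) ≠ 0) (j : Fin (m + 1 + 1)) :
    dualSeq h n j = (Fin.snoc (α := fun _ => ℂ) (fun j => -β j) 1 : Fin (m + 1 + 1) → ℂ) j
      / darbouxOp (seqInit h) (h (Fin.last (m + 1))) n := by
  have hne := darbouxOp_init_last_ne_zero h0 h1'
  set γ : Fin (m + 1 + 1) → ℂ := Fin.snoc (α := fun _ => ℂ) (fun j => -β j) 1 with hγ
  set T := darbouxOp (seqInit h) (h (Fin.last (m + 1))) n with hT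
  have e : ∀ i, ∑ j, γ j / T * h j i
      = (h (Fin.last (m + 1)) i - ∑ j, β j * seqInit h j i) / T := fun i => by
    rw [Fin.sum_univ_castSucc]
    simp only [hγ, Fin.snoc_castSucc, Fin.snoc_last]
    rw [sub_div, sum_div, sub_eq_neg_add, ← sum_neg_distrib]
    congr 1
    · exact sum_congr rfl fun j _ => by ring
    · ring
  rw [← sub_eq_zero]
  refine eq_zero_of_sum_mul_eq_zero h n (fun j => dualSeq h n j - γ j / T) h0
    (fun i hi hi' => ?_) j
  push_cast at hi'
  simp only [sub_mul, sum_sub_distrib]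
  rw [e]
  rcases eq_or_ne i n with rfl | hne'
  · rw [sum_dualSeq_mul_self h h0, ← hβ.darbouxOp_eq h1', ← hT, div_self hne, sub_self]
  · rw [sum_dualSeq_mul_eq_zero h h0 (by omega) (by push_cast; omega),
      hβ i (by omega) (by omega)]
    simp

end Composition

/-! ### The repeated transformation -/

/-- All steps of the repeated transformation generated by `h` are defined at the time `t`. -/
def StepsDefined {l : ℕ} (h : Fin l → LatticeFn) (t : ℝ) : Prop :=
  ∀ (k : ℕ) (hk : k ≤ l) (n : ℤ), seqCas (fun (i : Fin k) i' => h (Fin.castLE hk i) i' t) n ≠ 0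

namespace StepsDefined

variable {l : ℕ} {t : ℝ}

theorem init {h : Fin (l + 1) → LatticeFn} (hd : StepsDefined h t) :
    StepsDefined (fun i => h i.castSucc) t :=
  fun k hk n => hd k (hk.trans (Nat.le_succ l)) n

theorem seqCas_ne_zero {h : Fin l → LatticeFn} (hd : StepsDefined h t) (n : ℤ) :
    seqCas (fun i i' => h i i' t) n ≠ 0 :=
  hd l le_rfl n

theorem darbouxOp_succ {h : Fin (l + 1) → LatticeFn} (hd : StepsDefined h t) (ψ : ℤ → ℂ) (n : ℤ) :
    darbouxOp (fun i i' => h i i' t) ψ n = darbouxOp (fun i i' => h i.castSucc i' t) ψ n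
      - darbouxOp (fun i i' => h i.castSucc i' t) (fun i => h (Fin.last l) i t) n
        / darbouxOp (fun i i' => h i.castSucc i' t) (fun i => h (Fin.last l) i t) (n + 1)
        * darbouxOp (fun i i' => h i.castSucc i' t) ψ (n + 1) :=
  _root_.darbouxOp_succ (h := fun i i' => h i i' t) (hd.seqCas_ne_zero _)
    (hd.init.seqCas_ne_zero _) (hd.init.seqCas_ne_zero _) ψ

theorem repeatedEigen_eq {h : Fin l → LatticeFn} (hd : StepsDefined h t) (ψ : LatticeFn) (n : ℤ) :
    repeatedEigen l h ψ n t = darbouxOp (fun i i' => h i i' t) (fun i => ψ i t) n := by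
  induction l generalizing ψ n with
  | zero =>
    have := darbouxCoeff_zero (fun i i' => h i i' t) n (hd.seqCas_ne_zero _)
    simp [repeatedEigen, darbouxOp, this]
  | succ l ih =>
    rw [repeatedEigen, fdtEigen, hd.darbouxOp_succ]
    simp only [ih hd.init]

end StepsDefined

namespace TodaState

variable {N l m : ℕ} {S : TodaState N} {t : ℝ}

/-- The seeds of the repeated transformation matching the Casorati formulas of `D`. -/
noncomputable def signedSeeds (D : Fin l → DarbouxSeed) : Fin l → DarbouxSeed :=
  fun j => { D j with d := fun s => (-1) ^ (j : ℕ) * (D j).d s }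

theorem repeatedFDT_v {D : Fin l → DarbouxSeed} (hd : StepsDefined (fun j => (D j).h) t) (n : ℤ) :
    (S.repeatedFDT l (signedSeeds D)).v n t = S.v (n + (l : ℤ)) t
      * (seqCas (generators D t) (n + 1) * seqCas (generators D t) (n - 1)
        / seqCas (generators D t) n ^ 2) := by
  induction l generalizing n with
  | zero => simp [repeatedFDT, seqCas]
  | succ l ih =>
    have e : ∀ i, repeatedEigen l (fun i => (D i.castSucc).h) (D (Fin.last l)).h i t
        = (-1) ^ l * seqCas (generators D t) i / seqCas (seqInit (generators D t)) (i + 1) :=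
      fun i => (hd.init.repeatedEigen_eq _ i).trans (darbouxOp_init_last (generators D t) i)
    have hn : ∀ i, seqCas (generators D t) i ≠ 0 := hd.seqCas_ne_zero
    have hn' : ∀ i, seqCas (seqInit (generators D t)) i ≠ 0 := hd.init.seqCas_ne_zero
    have hv : (S.repeatedFDT (l + 1) (signedSeeds D)).v n t
        = (S.repeatedFDT l (signedSeeds fun i => D i.castSucc)).v (n + 1) t
          * (repeatedEigen l (fun i => (D i.castSucc).h) (D (Fin.last l)).h (n + 1) t
            * repeatedEigen l (fun i => (D i.castSucc).h) (D (Fin.last l)).h (n - 1) t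
            / repeatedEigen l (fun i => (D i.castSucc).h) (D (Fin.last l)).h n t ^ 2) := rfl
    rw [hv, ih hd.init, e, e, e, sub_add_cancel, add_sub_cancel_right,
      show n + 1 + (l : ℤ) = n + ((l + 1 : ℕ) : ℤ) by push_cast; ring]
    change _ * (seqCas (seqInit (generators D t)) (n + 1 + 1)
      * seqCas (seqInit (generators D t)) n
      / seqCas (seqInit (generators D t)) (n + 1) ^ 2) * _ = _
    have h1 := hn n
    have h2 := hn' n
    have h3 := hn' (n + 1)
    have h4 := hn' (n + 1 + 1)
    field_simp

/-- Principal logarithms do not add up over the steps; the exponentials of `2 * x` do multiply. -/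
theorem exp_repeatedFDT_x {D : Fin l → DarbouxSeed} (hd : StepsDefined (fun j => (D j).h) t)
    (n : ℤ) :
    Complex.exp (2 * (S.repeatedFDT l (signedSeeds D)).x n t)
      = Complex.exp (2 * S.x (n + (l : ℤ)) t)
        * (seqCas (generators D t) n / seqCas (generators D t) (n + 1)) ^ 2 := by
  induction l generalizing n with
  | zero => simp [repeatedFDT, seqCas]
  | succ l ih =>
    have e : ∀ i, repeatedEigen l (fun i => (D i.castSucc).h) (D (Fin.last l)).h i t
        = (-1) ^ l * seqCas (generators D t) i / seqCas (seqInit (generators D t)) (i + 1) :=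
      fun i => (hd.init.repeatedEigen_eq _ i).trans (darbouxOp_init_last (generators D t) i)
    have hn : ∀ i, seqCas (generators D t) i ≠ 0 := hd.seqCas_ne_zero
    have hn' : ∀ i, seqCas (seqInit (generators D t)) i ≠ 0 := hd.init.seqCas_ne_zero
    have hx : 2 * (S.repeatedFDT (l + 1) (signedSeeds D)).x n t
        = 2 * (S.repeatedFDT l (signedSeeds fun i => D i.castSucc)).x (n + 1) t
          + Complex.log ((repeatedEigen l (fun i => (D i.castSucc).h) (D (Fin.last l)).h n t
            / repeatedEigen l (fun i => (D i.castSucc).h) (D (Fin.last l)).h (n + 1) t) ^ 2) := by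
      change 2 * ((S.repeatedFDT l (signedSeeds fun i => D i.castSucc)).x (n + 1) t + 1 / 2 * _) = _
      rw [mul_add, ← mul_assoc]
      norm_num
      rfl
    have h1 := hn n
    have h1' := hn (n + 1)
    have h3 := hn' (n + 1)
    have h4 := hn' (n + 1 + 1)
    rw [hx, Complex.exp_add, ih hd.init, Complex.exp_log, e, e,
      show n + 1 + (l : ℤ) = n + ((l + 1 : ℕ) : ℤ) by push_cast; ring]
    · change _ * (seqCas (seqInit (generators D t)) (n + 1)
        / seqCas (seqInit (generators D t)) (n + 1 + 1)) ^ 2 * _ = _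
      field_simp
    · rw [e, e]
      exact pow_ne_zero _ (div_ne_zero (div_ne_zero (mul_ne_zero (by simp) h1) h3)
        (div_ne_zero (mul_ne_zero (by simp) h1') h4))

theorem repeatedFDT_ev (D : Fin l → DarbouxSeed) (y : LatticeFn) (k : Fin (N + l)) :
    (S.repeatedFDT l (signedSeeds D)).ev k = (S.casoratiFDT D y).ev k := by
  induction l with
  | zero =>
    refine Fin.addCases (fun a => ?_) (fun j => j.elim0) k
    exact (Fin.append_left S.ev (fun j => (D j).mu) a).symm
  | succ l ih =>
    change (Fin.snoc (α := fun _ => ℂ) (S.repeatedFDT l (signedSeeds fun i => D i.castSucc)).ev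
      (D (Fin.last l)).mu : Fin (N + l + 1) → ℂ) k = Fin.append S.ev (fun j => (D j).mu) k
    refine Fin.addCases (fun a => ?_) (fun j => ?_) k
    · have := ih (fun i => D i.castSucc) (Fin.castAdd l a)
      rw [Fin.append_left, show (Fin.castAdd (l + 1) a : Fin (N + l + 1))
        = (Fin.castAdd l a).castSucc from rfl, Fin.snoc_castSucc, this]
      simp [casoratiFDT]
    · rw [Fin.append_right]
      refine Fin.lastCases ?_ (fun j => ?_) j
      · exact Fin.snoc_last (α := fun _ => ℂ) _ _
      · have := ih (fun i => D i.castSucc) (Fin.natAdd N j)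
        rw [show (Fin.natAdd N j.castSucc : Fin (N + l + 1))
          = (Fin.natAdd N j).castSucc from rfl, Fin.snoc_castSucc, this]
        simp [casoratiFDT]

theorem repeatedFDT_plus {D : Fin l → DarbouxSeed} (hd : StepsDefined (fun j => (D j).h) t) :
    (∀ (a : Fin N) (n : ℤ), (S.repeatedFDT l (signedSeeds D)).plus (Fin.castAdd l a) n t
      = darbouxOp (generators D t) (fun i => S.plus a i t) n) ∧
    ∀ (j : Fin l) (n : ℤ), (S.repeatedFDT l (signedSeeds D)).plus (Fin.natAdd N j) n t
      = (D j).c t * darbouxOp (generators D t) (fun i => (D j).f i t) n := by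
  induction l with
  | zero =>
    refine ⟨fun a n => ?_, fun j => j.elim0⟩
    exact hd.repeatedEigen_eq (S.plus a) n
  | succ l ih =>
    -- The source added in the last step is `c` times the image of its `f` under all `l + 1` steps,
    -- by definition.
    have hplus : (S.repeatedFDT (l + 1) (signedSeeds D)).plus
        = (Fin.snoc (α := fun _ => LatticeFn) (fun i => fdtEigen
          (repeatedEigen l (fun i => (D i.castSucc).h) (D (Fin.last l)).h)
          ((S.repeatedFDT l (signedSeeds fun i => D i.castSucc)).plus i))
          (fun n s => (D (Fin.last l)).c s * repeatedEigen (l + 1) (fun i => (D i).h)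
            (D (Fin.last l)).f n s) : Fin (N + l + 1) → LatticeFn) := rfl
    obtain ⟨ih1, ih2'⟩ := ih hd.init
    have ih2 : ∀ (j : Fin l) (n : ℤ), (S.repeatedFDT l
        (signedSeeds fun i => D i.castSucc)).plus (Fin.natAdd N j) n t
        = (D j.castSucc).c t * darbouxOp (fun i i' => (D i.castSucc).h i' t)
          (fun i => (D j.castSucc).f i t) n := ih2'
    refine ⟨fun a n => ?_, fun j n => ?_⟩
    · rw [hplus, show (Fin.castAdd (l + 1) a : Fin (N + l + 1))
        = (Fin.castAdd l a).castSucc from rfl, Fin.snoc_castSucc, fdtEigen, ih1, ih1,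
        hd.init.repeatedEigen_eq, hd.init.repeatedEigen_eq]
      exact (hd.darbouxOp_succ (fun i => S.plus a i t) n).symm
    · rw [hplus]
      refine Fin.lastCases ?_ (fun j => ?_) j
      · refine (congrFun (congrFun (Fin.snoc_last (α := fun _ => LatticeFn) _ _) n) t).trans ?_
        rw [hd.repeatedEigen_eq]
        rfl
      · rw [show (Fin.natAdd N j.castSucc : Fin (N + l + 1))
          = (Fin.natAdd N j).castSucc from rfl, Fin.snoc_castSucc, fdtEigen, ih2, ih2,
          hd.init.repeatedEigen_eq, hd.init.repeatedEigen_eq]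
        have := hd.darbouxOp_succ (fun i => (D j.castSucc).f i t) n
        refine Eq.trans ?_ (congrArg ((D j.castSucc).c t * ·) this.symm)
        rw [mul_sub]
        ring

end TodaState

namespace TodaState

variable {N m : ℕ} {S : TodaState N} {t : ℝ}

theorem seqCas_one (h : Fin 1 → ℤ → ℂ) (n : ℤ) : seqCas h n = h 0 n := by
  simp [seqCas]

theorem repeatedFDT_p {D : Fin (m + 1) → DarbouxSeed} (hd : StepsDefined (fun j => (D j).h) t)
    (n : ℤ) :
    (S.repeatedFDT (m + 1) (signedSeeds D)).p n t
      = casP (fun i => S.p i t) (generators D t) n := by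
  induction m generalizing n with
  | zero =>
    have e : ∀ i, darbouxCoeff (generators D t) i 1 = -((D 0).h i t / (D 0).h (i + 1) t) :=
      fun i => by
        refine (darbouxCoeff_last (generators D t) i).trans ?_
        rw [seqCas_one, seqCas_one]
        simp only [generators]
        ring
    rw [casP, e, e, sub_add_cancel]
    change S.p n t - (D 0).h n t / (D 0).h (n + 1) t + (D 0).h (n - 1) t / (D 0).h n t = _
    ring
  | succ m ih =>
    have e : ∀ i, repeatedEigen (m + 1) (fun i => (D i.castSucc).h) (D (Fin.last (m + 1))).h i t
        = darbouxOp (seqInit (generators D t)) (generators D t (Fin.last (m + 1))) i :=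
      fun i => hd.init.repeatedEigen_eq _ i
    have hn : ∀ i, seqCas (generators D t) i ≠ 0 := hd.seqCas_ne_zero
    have hn' : ∀ i, seqCas (seqInit (generators D t)) i ≠ 0 := hd.init.seqCas_ne_zero
    have hp : (S.repeatedFDT (m + 1 + 1) (signedSeeds D)).p n t
        = (S.repeatedFDT (m + 1) (signedSeeds fun i => D i.castSucc)).p n t
          - repeatedEigen (m + 1) (fun i => (D i.castSucc).h) (D (Fin.last (m + 1))).h n t
            / repeatedEigen (m + 1) (fun i => (D i.castSucc).h) (D (Fin.last (m + 1))).h (n + 1) t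
          + repeatedEigen (m + 1) (fun i => (D i.castSucc).h) (D (Fin.last (m + 1))).h (n - 1) t
            / repeatedEigen (m + 1) (fun i => (D i.castSucc).h) (D (Fin.last (m + 1))).h n t := rfl
    rw [hp, ih hd.init, e, e, e, casP, casP, darbouxCoeff_one_succ (hn _) (hn' _) (hn' _),
      darbouxCoeff_one_succ (hn _) (hn' _) (hn' _), sub_add_cancel]
    change S.p n t + darbouxCoeff (seqInit (generators D t)) n 1
      - darbouxCoeff (seqInit (generators D t)) (n - 1) 1 - _ + _ = _
    ring

theorem IsDressing.init {D : Fin (m + 1 + 1) → DarbouxSeed} (H : S.IsDressing D) :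
    S.IsDressing fun j => D j.castSucc where
  sol := H.sol
  f_eigen j := H.f_eigen j.castSucc
  g_eigen j := H.g_eigen j.castSucc
  mu_ne_ev j := H.mu_ne_ev j.castSucc
  α_diff j := H.α_diff j.castSucc
  α_ne_zero j := H.α_ne_zero j.castSucc
  cd_eq j := H.cd_eq j.castSucc

/-- In the induction step the new potential is a bilinear form of already transformed functions.
With the last generator as eigenfunction, `Interpolates.casV_mul_sub` reduces it to S - Σ β_j S_j
for an original source, and `Interpolates.sub_eigenvalue_mul` to a multiple of -β_j for an added
one. Division by the transformed generator then yields the new duals by `dualSeq_succ`. -/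
theorem IsDressing.repeatedFDT_minus {D : Fin (m + 1) → DarbouxSeed} (H : S.IsDressing D)
    (hmu : Function.Injective fun j => (D j).mu)
    (hd : StepsDefined (fun j => (D j).h) t) :
    (∀ (a : Fin N) (n : ℤ),
      (S.repeatedFDT (m + 1) (signedSeeds D)).minus (Fin.castAdd (m + 1) a) n t
        = ∑ j, dualSeq (generators D t) n j * S.potential D t a j n) ∧
    ∀ (j : Fin (m + 1)) (n : ℤ),
      (S.repeatedFDT (m + 1) (signedSeeds D)).minus (Fin.natAdd N j) n t
        = (D j).d t * ((-1) ^ (j : ℕ) * dualSeq (generators D t) n j) := by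
  induction m with
  | zero =>
    have hu : ∀ n, dualSeq (generators D t) n 0 = 1 / (D 0).h n t := fun n => by
      rw [dualSeq_eq, seqCas_one]
      simp [seqCas, generators]
    have hminus : (S.repeatedFDT 1 (signedSeeds D)).minus
        = (Fin.snoc (α := fun _ => LatticeFn) (fun i n s =>
          sourceSum S.v (S.ev i) (S.minus i) (D 0).mu (D 0).h n s / (D 0).h n s)
          (fun n s => (-1) ^ 0 * (D 0).d s * (1 / (D 0).h n s)) : Fin (N + 1) → LatticeFn) := rfl
    refine ⟨fun a n => ?_, fun j n => ?_⟩
    · rw [hminus, show (Fin.castAdd 1 a : Fin (N + 1)) = a.castSucc from rfl, Fin.snoc_castSucc,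
        sourceSum_eq (p := S.p) (H.sol.minus_spectral a t) (H.generators_spectral t 0)
        (H.mu_ne_ev 0 a)]
      simp only [Nat.reduceAdd, univ_unique, Fin.default_eq_zero, Fin.isValue, sum_singleton, hu]
      rw [one_div, inv_mul_eq_div]
      rfl
    · obtain rfl : j = 0 := Fin.fin_one_eq_zero j
      rw [hminus, hu]
      refine (congrFun (congrFun (Fin.snoc_last (α := fun _ => LatticeFn) _ _) n) t).trans ?_
      simp
  | succ m ih =>
    obtain ⟨ih1, ih2⟩ := ih H.init (hmu.comp (Fin.castSucc_injective _)) hd.init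
    set R := S.repeatedFDT (m + 1) (signedSeeds fun i => D i.castSucc) with hR
    set w := repeatedEigen (m + 1) (fun i => (D i.castSucc).h) (D (Fin.last (m + 1))).h with hw
    set h := generators D t with hh
    set μ := (D (Fin.last (m + 1))).mu with hμ
    have e : ∀ i, w i t = darbouxOp (seqInit h) (h (Fin.last (m + 1))) i :=
      fun i => hd.init.repeatedEigen_eq _ i
    have hn : ∀ i, seqCas h i ≠ 0 := hd.seqCas_ne_zero
    have hn' : ∀ i, seqCas (seqInit h) i ≠ 0 := hd.init.seqCas_ne_zero
    have hv : ∀ i, R.v i t = casV (fun i => S.v i t) (seqInit h) i :=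
      fun i => repeatedFDT_v hd.init i
    have hp : ∀ i, R.p i t = casP (fun i => S.p i t) (seqInit h) i :=
      fun i => repeatedFDT_p hd.init i
    have hL : ∀ j i, S.v (i + 1) t * seqInit h j (i + 1) + S.p i t * seqInit h j i
        + seqInit h j (i - 1) = (D j.castSucc).mu * seqInit h j i :=
      H.init.generators_spectral t
    have hlast : ∀ i, S.v (i + 1) t * h (Fin.last (m + 1)) (i + 1)
        + S.p i t * h (Fin.last (m + 1)) i + h (Fin.last (m + 1)) (i - 1)
        = μ * h (Fin.last (m + 1)) i := H.generators_spectral t _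
    have hwL : ∀ i, R.v (i + 1) t * w (i + 1) t + R.p i t * w i t + w (i - 1) t = μ * w i t :=
      fun i => by
        simp only [hv, hp, e]
        exact darbouxOp_spectral (v := fun i => S.v i t) (p := fun i => S.p i t) hL hlast
          (hn' _) (hn' _) (hn' _)
    have hminus : (S.repeatedFDT (m + 1 + 1) (signedSeeds D)).minus
        = (Fin.snoc (α := fun _ => LatticeFn) (fun i n s =>
          sourceSum R.v (R.ev i) (R.minus i) μ w n s / w n s)
          (fun n s => (-1) ^ (m + 1) * (D (Fin.last (m + 1))).d s * (1 / w n s)) :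
            Fin (N + (m + 1) + 1) → LatticeFn) := rfl
    -- The logarithm argument does not enter the eigenvalues, so any value serves.
    have hev := repeatedFDT_ev (S := S) (fun i => D i.castSucc) 0
    have hβ : ∀ n, ∃ β, Interpolates (seqInit h) n (h (Fin.last (m + 1))) β :=
      fun n => exists_interpolates _ (hn' _)
    refine ⟨fun a n => ?_, fun j n => ?_⟩
    · obtain ⟨β, hβ⟩ := hβ n
      have hev' : R.ev (Fin.castAdd (m + 1) a) = S.ev a := by
        rw [hR, hev]
        simp [casoratiFDT]
      have hφ : ∀ i, R.v i t * R.minus (Fin.castAdd (m + 1) a) (i - 1) t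
          + R.p i t * R.minus (Fin.castAdd (m + 1) a) i t
          + R.minus (Fin.castAdd (m + 1) a) (i + 1) t
          = S.ev a * R.minus (Fin.castAdd (m + 1) a) i t := fun i => by
        simp only [hv, hp, ih1]
        exact dualSource_spectral (v := fun i => S.v i t) (p := fun i => S.p i t)
          (H.init.potential_sub_pred t a) hL (H.init.sub_mul_potential t a)
          (hn' _) (hn' _) (hn' _)
      have hne : μ ≠ S.ev a := H.mu_ne_ev _ a
      have key := hβ.casV_mul_sub (v := fun i => S.v i t) (p := fun i => S.p i t)
        (H.init.potential_sub_pred t a) hL (H.init.sub_mul_potential t a) hlast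
        (hn' _) (hn' _) (hn' _)
      rw [hminus, show (Fin.castAdd (m + 1 + 1) a : Fin (N + (m + 1) + 1))
        = (Fin.castAdd (m + 1) a).castSucc from rfl, Fin.snoc_castSucc, hev',
        sourceSum_eq (p := R.p) hφ hwL hne, sourceSeq, adjCas]
      simp only [hv, e, ih1]
      have key' : (μ - S.ev a)⁻¹ * (casV (fun i => S.v i t) (seqInit h) (n + 1)
            * darbouxOp (seqInit h) (h (Fin.last (m + 1))) (n + 1)
            * (∑ j, dualSeq (seqInit h) n j * S.potential (fun j => D j.castSucc) t a j n)
          - darbouxOp (seqInit h) (h (Fin.last (m + 1))) n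
            * ∑ j, dualSeq (seqInit h) (n + 1) j
              * S.potential (fun j => D j.castSucc) t a j (n + 1))
          = S.potential D t a (Fin.last (m + 1)) n
            - ∑ j, β j * S.potential (fun j => D j.castSucc) t a j n := by
        refine (congrArg ((μ - S.ev a)⁻¹ * ·) key).trans ?_
        rw [mul_sub, inv_mul_cancel_left₀ (sub_ne_zero.2 hne)]
        rfl
      refine (congrArg (· / darbouxOp (seqInit h) (h (Fin.last (m + 1))) n) key').trans ?_
      simp only [dualSeq_succ (h := h) hβ (hn n) (hn' _)]
      rw [Fin.sum_univ_castSucc (n := m + 1)]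
      simp only [Fin.snoc_castSucc, Fin.snoc_last]
      rw [sub_div, sub_eq_neg_add, sum_div, ← sum_neg_distrib]
      congr 1
      · refine sum_congr rfl fun j _ => ?_
        rw [show S.potential (fun j => D j.castSucc) t a j n
          = S.potential D t a j.castSucc n from rfl]
        ring
      · ring
    · rw [hminus]
      obtain ⟨β, hβ⟩ := hβ n
      refine Fin.lastCases ?_ (fun j => ?_) j
      · refine (congrFun (congrFun (Fin.snoc_last (α := fun _ => LatticeFn) _ _) n) t).trans ?_
        rw [e, dualSeq_succ (h := h) hβ (hn n) (hn' _), Fin.snoc_last, Fin.val_last]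
        ring
      · have hev' : R.ev (Fin.natAdd N j) = (D j.castSucc).mu := by
          rw [hR, hev]
          simp [casoratiFDT]
        have hφ : ∀ i, R.v i t * R.minus (Fin.natAdd N j) (i - 1) t
            + R.p i t * R.minus (Fin.natAdd N j) i t + R.minus (Fin.natAdd N j) (i + 1) t
            = (D j.castSucc).mu * R.minus (Fin.natAdd N j) i t := fun i => by
          simp only [hv, hp, ih2]
          have := dualSeq_spectral (v := fun i => S.v i t) (p := fun i => S.p i t) hL
            (hn' (i - 1)) (hn' i) (hn' (i + 1)) j
          change _ * (_ * (_ * dualSeq (seqInit h) (i - 1) j))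
            + _ * (_ * (_ * dualSeq (seqInit h) i j)) + _ * (_ * dualSeq (seqInit h) (i + 1) j)
            = _ * (_ * (_ * dualSeq (seqInit h) i j))
          linear_combination (D j.castSucc).d t * (-1) ^ (j : ℕ) * this
        -- Distinct spectral parameters allow an earlier added source to be integrated against the
        -- new generator.
        have hne : μ ≠ (D j.castSucc).mu := fun h0 =>
          (Fin.castSucc_lt_last j).ne (hmu h0).symm
        have key := hβ.sub_eigenvalue_mul (v := fun i => S.v i t) (p := fun i => S.p i t)
          hL hlast (hn' _) (hn' _) (hn' _) j
        rw [show (Fin.natAdd N j.castSucc : Fin (N + (m + 1) + 1))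
          = (Fin.natAdd N j).castSucc from rfl, Fin.snoc_castSucc, hev',
          sourceSum_eq (p := R.p) hφ hwL hne, sourceSeq, adjCas]
        simp only [hv, e, ih2]
        rw [dualSeq_succ (h := h) hβ (hn n) (hn' _), Fin.snoc_castSucc]
        change (μ - (D j.castSucc).mu)⁻¹ * (casV (fun i => S.v i t) (seqInit h) (n + 1)
            * darbouxOp (seqInit h) (h (Fin.last (m + 1))) (n + 1)
            * ((D j.castSucc).d t * ((-1) ^ (j : ℕ) * dualSeq (seqInit h) n j))
          - darbouxOp (seqInit h) (h (Fin.last (m + 1))) n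
            * ((D j.castSucc).d t * ((-1) ^ (j : ℕ) * dualSeq (seqInit h) (n + 1) j))) / _ = _
        have e3 : casV (fun i => S.v i t) (seqInit h) (n + 1)
            * darbouxOp (seqInit h) (h (Fin.last (m + 1))) (n + 1)
            * ((D j.castSucc).d t * ((-1) ^ (j : ℕ) * dualSeq (seqInit h) n j))
          - darbouxOp (seqInit h) (h (Fin.last (m + 1))) n
            * ((D j.castSucc).d t * ((-1) ^ (j : ℕ) * dualSeq (seqInit h) (n + 1) j))
          = (μ - (D j.castSucc).mu) * (-((D j.castSucc).d t * (-1) ^ (j : ℕ) * β j)) := by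
          linear_combination (D j.castSucc).d t * (-1) ^ (j : ℕ) * key
        rw [e3, inv_mul_cancel_left₀ (sub_ne_zero.2 hne), Fin.val_castSucc]
        ring

end TodaState

end

/-! ### The theorem -/

theorem theorem2 (N l : ℕ) (hl : 1 ≤ l)
    -- a solution with `N` sources
    (S : TodaState N) (hS : S.IsSolution)
    -- pairs of eigenfunctions at distinct `μ_1, …, μ_l`
    (D : Fin l → DarbouxSeed)
    (hf : ∀ j n t, S.IsEigenfunctionAt (D j).mu (D j).f n t)
    (hg : ∀ j n t, S.IsEigenfunctionAt (D j).mu (D j).g n t)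
    (hmu : Function.Injective fun j => (D j).mu)
    (hmu_ev : ∀ j i, (D j).mu ≠ S.ev i)
    -- the time functions; `j : Fin l` is counted from `0`
    (hα : ∀ j, Differentiable ℝ (D j).α) (hα0 : ∀ j t, (D j).α t ≠ 0)
    (hc : ∀ j, Differentiable ℝ (D j).c) (hd : ∀ j, Differentiable ℝ (D j).d)
    (hcd : ∀ j t, (D j).c t * (D j).d t
      = (-1) ^ ((j : ℕ) + 1) * (deriv (D j).α t / (D j).α t))
    -- an eigenfunction of the Lax pair at a further spectral parameter
    (lam : ℂ) (ψ : LatticeFn)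
    (hlam_ev : ∀ i, lam ≠ S.ev i) (hlam_mu : ∀ j, lam ≠ (D j).mu)
    (hψ : ∀ n t, S.IsEigenfunctionAt lam ψ n t) :
    -- the Casorati formulas give the `l`-times repeated transformation, whenever all steps are
    -- defined (each step has the product of its two time functions equal to `-α̇/α`)
    (∀ t, (∀ (k : ℕ) (hk : k ≤ l) (n : ℤ),
        cas (fun i : Fin k => (D (Fin.castLE hk i)).h) n t ≠ 0) →
      ∀ n,
        let R := S.repeatedFDT l
          (fun j => { D j with d := fun s => (-1) ^ (j : ℕ) * (D j).d s })
        let C := S.casoratiFDT D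
          (fun m s => Complex.log (casRatioSq (fun j => (D j).h) m s))
        repeatedEigen l (fun j => (D j).h) ψ n t = casEigen (fun j => (D j).h) ψ n t ∧
        R.v n t = C.v n t ∧
        R.p n t = C.p n t ∧
        (∃ k : ℤ, R.x n t = C.x n t + k * (Real.pi * Complex.I)) ∧
        (∀ i, R.plus i n t = C.plus i n t) ∧
        (∀ i, R.minus i n t = C.minus i n t) ∧
        (∀ i, R.ev i = C.ev i)) ∧
    -- the Casorati formulas give a solution with `N + l` sources, wherever they are defined
    (∀ (y : LatticeFn) (n : ℤ) (t : ℝ),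
      (∀ m ∈ Finset.Icc (n - 1) (n + 2), cas (fun j => (D j).h) m t ≠ 0) →
      let C := S.casoratiFDT D y
      C.SolvesTLSCSAt n t ∧
      C.IsEigenfunctionAt lam (casEigen (fun j => (D j).h) ψ) n t ∧
      ((∀ m ∈ Finset.Icc (n - 1) (n + 1),
          IsLogBranchAt (y m) (casRatioSq (fun j => (D j).h) m) t) →
        C.MomentumAt n t ∧
        (Complex.exp (C.x (n - 1) t - C.x n t) = C.v n t ∨
          Complex.exp (C.x (n - 1) t - C.x n t) = -C.v n t) ∧
        (C.ExpAt n t → C.ExpAt (n + 1) t → C.SolvesODEAt n t))) := by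

  obtain ⟨m, rfl⟩ : ∃ m, l = m + 1 := ⟨l - 1, by omega⟩
  have H : S.IsDressing D := ⟨hS, hf, hg, hmu_ev, hα, hα0, hcd⟩
  refine ⟨fun t hcas n => ?_, fun y n t hcas => ?_⟩
  · have hsteps : StepsDefined (fun j => (D j).h) t := hcas
    intro R C
    have hv : R.v n t = C.v n t := TodaState.repeatedFDT_v hsteps n
    refine ⟨?_, hv, ?_, ?_, fun i => ?_, fun i => ?_, fun i => ?_⟩
    · rw [hsteps.repeatedEigen_eq]
      exact (casCons_div_cas _ _ _ _).symm
    · exact (TodaState.repeatedFDT_p hsteps n).trans (TodaState.casoratiFDT_p S D _ n t).symm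
    · have hx := TodaState.exp_repeatedFDT_x (S := S) hsteps n
      have h0 : cas (fun j => (D j).h) n t ≠ 0 := hsteps.seqCas_ne_zero n
      have h1 : cas (fun j => (D j).h) (n + 1) t ≠ 0 := hsteps.seqCas_ne_zero (n + 1)
      have hC : Complex.exp (2 * C.x n t) = Complex.exp (2 * S.x (n + ((m + 1 : ℕ) : ℤ)) t)
          * casRatioSq (fun j => (D j).h) n t := by
        have : 2 * C.x n t = 2 * S.x (n + ((m + 1 : ℕ) : ℤ)) t
            + Complex.log (casRatioSq (fun j => (D j).h) n t) := by
          simp only [C, TodaState.casoratiFDT]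
          ring
        have hr : casRatioSq (fun j => (D j).h) n t ≠ 0 := pow_ne_zero _ (div_ne_zero h0 h1)
        rw [this, Complex.exp_add, Complex.exp_log hr]
      -- The doubled fields agree modulo 2πi, hence the fields modulo πi.
      obtain ⟨k, hk⟩ := Complex.exp_eq_exp_iff_exists_int.1 (hx.trans hC.symm)
      refine ⟨k, ?_⟩
      have hk' : 2 * R.x n t = 2 * C.x n t + k * (2 * Real.pi * Complex.I) := hk
      linear_combination hk' / 2
    · refine Fin.addCases (fun a => ?_) (fun j => ?_) i
      · exact ((TodaState.repeatedFDT_plus hsteps).1 a n).trans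
          (TodaState.casoratiFDT_plus_castAdd S D _ n t a).symm
      · exact ((TodaState.repeatedFDT_plus hsteps).2 j n).trans
          (TodaState.casoratiFDT_plus_natAdd S D _ n t j).symm
    · refine Fin.addCases (fun a => ?_) (fun j => ?_) i
      · exact ((H.repeatedFDT_minus hmu hsteps).1 a n).trans
          (H.casoratiFDT_minus_castAdd _ a n t).symm
      · exact ((H.repeatedFDT_minus hmu hsteps).2 j n).trans
          (TodaState.casoratiFDT_minus_natAdd S D _ n t j).symm
    · exact TodaState.repeatedFDT_ev D _ i
  · intro C
    have hne : ∀ i, n - 1 ≤ i → i ≤ n + 2 → seqCas (TodaState.generators D t) i ≠ 0 :=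
      fun i h1 h2 => hcas i (Finset.mem_Icc.2 ⟨h1, h2⟩)
    have hm := hne (n - 1) le_rfl (by omega)
    have h0 := hne n (by omega) (by omega)
    have h1 := hne (n + 1) (by omega) (by omega)
    have h2 := hne (n + 2) (by omega) le_rfl
    refine ⟨H.solvesTLSCSAt hc hd y hm h0 h1 h2,
      H.isEigenfunctionAt hlam_ev hlam_mu hψ y h0 h1 h2, fun hy => ?_⟩
    have hyn := hy n (by simp)
    exact ⟨H.momentumAt h0 h1 hyn, H.exp_eq_or h0 hyn (hy (n - 1) (by simp; omega)),
      fun hv hv' => H.solvesODEAt hc hd hm h0 h1 h2 hyn hv hv'⟩
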